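/- For $u,v\in\mathscr S(\mathbb R)$ let $$\mathcal W(u,v)(x,\xi)=\int_{\mathbb R}e^{-2i\pi z\xi}\,u\bigl(x+\tfrac z2\bigr)\overline{v\bigl(x-\tfrac z2\bigr)}\,dz .$$ Let $A$ be the Weyl quantization of the characteristic function of the quarter-plane $C_0=\{(x,\xi)\in\mathbb R^2:\ x\ge 0,\ \xi\ge 0\}$, i.e. the unique bounded operator on $L^2(\mathbb R)$ such that $$\langle Au,v\rangle_{L^2(\mathbb R)}=\iint_{C_0}\mathcal W(u,v)(x,\xi)\,dx\,d\xi\qquad\text{for all }u,v\in\mathscr S(\mathbb R)$$ (such an operator exists and is unique; inner products are linear in the first argument and conjugate-linear in the second). For $\varepsilon>0$ and $j,k\in\mathbb Z$ put $$a_{j,k,\varepsilon}=\bigl\langle A\mathbf 1_{(j\varepsilon,(j+1)\varepsilon)},\mathbf 1_{(k\varepsilon,(k+1)\varepsilon)}\bigr\rangle_{L^2(\mathbb R)},\qquad a_{j,k}=a_{j,k,1},$$ and for $l\in\mathbb Z$ put $$\Phi(l)=\frac1{2\pi}\int_l^{l+1}\log\left|\frac{y}{y-1}\right|dy .$$ Let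 $\mathbf 1_{\mathbb N}$ be the indicator function of $\mathbb N=\{0,1,2,\dots\}$ on $\mathbb Z$ and $\delta$ the Kronecker symbol. **Proposition 3.1.** For all $\varepsilon>0$ and $j,k\in\mathbb Z$ we have $a_{j,k,\varepsilon}=\varepsilon\,a_{j,k}$, and $$a_{j,k}=\mathbf 1_{\mathbb N}(j)\frac{\delta_{j,k}}2+i\Bigl(\mathbf 1_{\mathbb N}(j+k)\Phi(k-j)+\frac{\delta_{j,-k-1}}2\Phi(2k+1)\Bigr)$$ $$\phantom{a_{j,k}}=\mathbf 1_{\mathbb N}(j)\mathbf 1_{\mathbb N}(k)\frac{\delta_{j,k}}2+i\,\Phi(k-j)\Bigl(\mathbf 1_{\mathbb N}(j+k)+\frac{\delta_{j+k+1,0}}2\Bigr).$$ Moreover, the matrix $(a_{j,k})_{j,k\in\mathbb Z}$ defines a bounded self-adjoint operator $\mathbf Q$ on $\ell^2(\mathbb Z)$, given by $(\mathbf Qz)_k=\sum_{j\in\mathbb Z}a_{j,k}z_j$, that is, $\langle \mathbf Qz,w\rangle=\sum_{k\in\mathbb Z}\bigl(\sum_{j\in\mathbb Z}a_{j,k}z_j\bigr)\overline{w_k}$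 for $z,w\in\ell^2(\mathbb Z)$. -/

import Mathlib

open MeasureTheory
open scoped ENNReal ComplexConjugate SchwartzMap

noncomputable section

/-- The Hilbert space `L²(ℝ)` of complex-valued functions. -/
abbrev L2R : Type := Lp ℂ 2 (volume : Measure ℝ)

/-- The Hilbert space `ℓ²(ℤ)` of complex sequences. -/
abbrev ell2Z : Type := lp (fun _ : ℤ => ℂ) 2

/-- The cross-Wigner distribution
`W(u,v)(x,ξ) = ∫ u(x + z/2) conj(v(x - z/2)) exp(-2iπ z ξ) dz` of two functions on the line. -/
def wigner (u v : ℝ → ℂ) (p : ℝ × ℝ) : ℂ :=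
  ∫ z : ℝ, u (p.1 + z / 2) * conj (v (p.1 - z / 2)) *
    Complex.exp (-(2 * Real.pi * z * p.2 : ℝ) * Complex.I)

/-- `A`, a bounded operator on `L²(ℝ)`, is the Weyl quantization of the bounded measurable symbol
`a` on the phase plane: `⟨A u, v⟩ = ∬ a(x,ξ) W(u,v)(x,ξ) dx dξ` for all Schwartz functions
`u, v`. (Mathlib's inner product is conjugate-linear in its first argument.) -/
def IsWeylQuantization (a : ℝ × ℝ → ℂ) (A : L2R →L[ℂ] L2R) : Prop :=
  ∀ u v : 𝓢(ℝ, ℂ),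
    inner ℂ (v.toLp 2 volume : L2R) (A (u.toLp 2 volume)) = ∫ p : ℝ × ℝ, a p * wigner u v p

/-- The characteristic function `H(x) H(ξ)` of the quarter-plane `x ≥ 0, ξ ≥ 0`. -/
def quarterPlaneSymbol : ℝ × ℝ → ℂ :=
  Set.indicator {p : ℝ × ℝ | 0 ≤ p.1 ∧ 0 ≤ p.2} 1

/-- The characteristic function of `(jε, (j+1)ε)`, as an element of `L²(ℝ)`. -/
def gridIndicator (ε : ℝ) (j : ℤ) : L2R :=
  indicatorConstLp 2 (measurableSet_Ioo (a := (j : ℝ) * ε) (b := ((j : ℝ) + 1) * ε))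
    measure_Ioo_lt_top.ne 1

/-- The matrix entry `⟨A 1_{(jε,(j+1)ε)}, 1_{(kε,(k+1)ε)}⟩`, the bracket being linear on the
left and conjugate-linear on the right. -/
def gridEntry (A : L2R →L[ℂ] L2R) (ε : ℝ) (j k : ℤ) : ℂ :=
  inner ℂ (gridIndicator ε k) (A (gridIndicator ε j))

/-- `Φ(l) = (1/2π) ∫_l^{l+1} log |y/(y-1)| dy`. -/
def Phi (l : ℤ) : ℝ :=
  1 / (2 * Real.pi) * ∫ y in (l : ℝ)..((l : ℝ) + 1), Real.log |y / (y - 1)|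

/-- The indicator function of the nonnegative integers, on `ℤ`. -/
def indN (m : ℤ) : ℂ := if 0 ≤ m then 1 else 0

/-- The Kronecker symbol on `ℤ`. -/
def kron (m n : ℤ) : ℂ := if m = n then 1 else 0

/-- `Q`, a bounded operator on `ℓ²(ℤ)`, is the operator with matrix `(a j k)`, in the convention
`⟨Q e_j, e_k⟩ = a j k`, i.e. `(Q z)_k = ∑_j a j k z_j`, and so
`⟨Q z, w⟩ = ∑_k (∑_j a j k z_j) conj(w_k)`. -/
def IsMatrixOperator (a : ℤ → ℤ → ℂ) (Q : ell2Z →L[ℂ] ell2Z) : Prop :=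
  ∀ (z : ell2Z) (k : ℤ), HasSum (fun j : ℤ => a j k * z j) (Q z k)

end

noncomputable section

open FourierTransform Filter Topology

/-! With `s = x + z/2` and `t = x - z/2`, the quantization of `H(x)H(ξ)` has kernel `H(s+t)` times
the boundary value, as `ε → 0+`, of `1/(2π(ε + i(s-t)))`, the Fourier transform of the Heaviside
function. The half-plane `s + t ≥ 0` is the quadrant `s, t ≥ 0` together with `mixedRegion`. On the
quadrant the form is a Fourier multiplier `H(ξ)` between two truncations, bounded by Plancherel. On
`mixedRegion` the kernel is singular only at the origin, and a Schur test with weight `|t|^(-1/2)`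
bounds it (`lintegral_mixedKernel_le`). Both pieces are Hermitian.

The link with concrete integrals is `tendsto_inner_quarterPlaneOperator`: for `u, v` in `L¹ ∩ L²`
the form is the limit of integrals against the regularised kernel. For Schwartz functions, Abel
summation and the integrability of the Wigner distribution give the same limit for the phase-space
integral, which is the Weyl identity; density gives uniqueness.

For two unit cells the regularised integral over the whole plane is a second difference of the
primitive `-(z log z - z)/(2π)`, `z = η + iw`. In the limit, `log(iw) = log|w| + sgn(w) iπ/2`; the
logarithm gives `Φ`, and the jump of the argument gives `|w|/4`, whose second difference is `δ/2`.
The product cell lies in the half-plane when `j + k ≥ 0`, outside it (up to a null set) when `j + k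
< -1`, and is halved by the line `s + t = 0` when `j + k = -1`. The entries are those of `A`
compressed to an orthonormal family, so boundedness and self-adjointness pass to `ℓ²(ℤ)`. -/

theorem L2R_locallyIntegrable (f : L2R) : LocallyIntegrable f volume :=
  (Lp.memLp f).locallyIntegrable (by norm_num)

/-- On `L¹ ∩ L²` the `L²` Fourier transform is the Fourier integral. -/
theorem coeFn_fourier_toLp {f : ℝ → ℂ} (hf : Integrable f) (hf2 : MemLp f 2) :
    (Lp.fourierTransformₗᵢ ℝ ℂ (hf2.toLp f) : ℝ → ℂ) =ᵐ[volume] 𝓕 f := by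
  have hcont : Continuous (𝓕 f) :=
    VectorFourier.fourierIntegral_continuous Real.continuous_fourierChar
      (by exact continuous_inner) hf
  refine ae_eq_of_integral_contDiff_smul_eq (L2R_locallyIntegrable _) hcont.locallyIntegrable ?_
  intro g hg hgc
  have h1 : HasCompactSupport (fun x => (g x : ℂ)) := hgc.comp_left (g := Complex.ofReal) rfl
  let G : 𝓢(ℝ, ℂ) := h1.toSchwartzMap (Complex.ofRealCLM.contDiff.comp hg)
  have hG : ∀ x, G x = (g x : ℂ) := fun x => rfl
  -- The `L²` transform is compatible with the distributional one, which moves onto the test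
  -- function; self-adjointness of the Fourier integral then moves it onto `f`.
  have key : 𝓕 (Lp.toTemperedDistribution (hf2.toLp f)) G =
      Lp.toTemperedDistribution (𝓕 (hf2.toLp f)) G := by
    rw [Lp.fourier_toTemperedDistribution_eq]
  rw [TemperedDistribution.fourier_apply, Lp.toTemperedDistribution_apply,
    Lp.toTemperedDistribution_apply] at key
  have h2 : ∫ x, (𝓕 G) x • (hf2.toLp f : ℝ → ℂ) x = ∫ x, G x • 𝓕 f x := by
    rw [SchwartzMap.fourier_coe]
    have := VectorFourier.integral_fourierIntegral_smul_eq_flip (μ := volume) (ν := volume)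
      (L := innerₗ ℝ) (f := G) (g := f) Real.continuous_fourierChar
      (by exact continuous_inner) G.integrable hf
    rw [flip_innerₗ] at this
    rw [← show ∫ x, 𝓕 (G : ℝ → ℂ) x • f x = ∫ x, G x • 𝓕 f x from this]
    refine integral_congr_ae ?_
    filter_upwards [hf2.coeFn_toLp] with x hx
    rw [hx]
  rw [h2] at key
  simp only [hG, Complex.coe_smul] at key
  exact key.symm

/-! ### Regularised kernel and Abel summation -/

/-- The regularised Fourier transform `1 / (2π(ε + iw))` of the Heaviside function. -/
def resolventKernel (ε w : ℝ) : ℂ := 1 / (2 * Real.pi * (ε + w * Complex.I))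

theorem measurable_resolventKernel (ε : ℝ) : Measurable (resolventKernel ε) := by
  unfold resolventKernel; fun_prop

theorem resolventKernel_eq_integral {ε : ℝ} (hε : 0 < ε) (w : ℝ) :
    ∫ ξ in Set.Ioi (0 : ℝ), (Real.exp (-(2 * Real.pi * ε * ξ)) : ℂ) *
      Complex.exp (-(2 * Real.pi * w * ξ : ℝ) * Complex.I) = resolventKernel ε w := by
  have ha : (-(2 * Real.pi * (ε + w * Complex.I)) : ℂ).re < 0 := by
    simp; positivity
  have := integral_exp_mul_complex_Ioi ha 0
  simp only [Complex.ofReal_zero, mul_zero, Complex.exp_zero, neg_div_neg_eq] at this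
  rw [resolventKernel, ← this]
  refine integral_congr_ae (.of_forall fun ξ => ?_)
  simp only
  rw [Complex.ofReal_exp, ← Complex.exp_add]
  congr 1
  push_cast
  ring

/-- Uniform in `ε`, so it serves as a majorant for the limit `ε → 0` and for the limiting kernel
itself. -/
theorem norm_resolventKernel_le_inv (ε : ℝ) {w : ℝ} (hw : w ≠ 0) :
    ‖resolventKernel ε w‖ ≤ |w|⁻¹ := by
  have h1 : |w| ≤ ‖(ε + w * Complex.I : ℂ)‖ := by
    simpa using Complex.abs_im_le_norm (ε + w * Complex.I : ℂ)
  have h2 : (1 : ℝ) ≤ ‖(2 * Real.pi : ℂ)‖ := by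
    have : ‖(2 * Real.pi : ℂ)‖ = 2 * Real.pi := by
      simp [abs_of_pos Real.pi_pos]
    rw [this]; linarith [Real.pi_gt_three]
  have h0 : 0 < |w| := abs_pos.2 hw
  rw [resolventKernel, norm_div, norm_one, one_div, norm_mul]
  refine inv_anti₀ h0 ?_
  nlinarith

theorem norm_exp_neg_mul_I (x : ℝ) : ‖Complex.exp (-(x : ℂ) * Complex.I)‖ = 1 := by
  rw [← Complex.ofReal_neg, Complex.norm_exp_ofReal_mul_I]

/-- Fubini: the damping factor makes the double integral over `a` and `ξ` absolutely convergent. -/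
theorem integral_mul_resolventKernel {α : Type*} [MeasurableSpace α] {μ : Measure α} [SFinite μ]
    {F : α → ℂ} (hF : Integrable F μ) {w : α → ℝ} (hw : Measurable w) {ε : ℝ} (hε : 0 < ε) :
    ∫ a, F a * resolventKernel ε (w a) ∂μ =
      ∫ ξ in Set.Ioi (0 : ℝ), (Real.exp (-(2 * Real.pi * ε * ξ)) : ℂ) *
        ∫ a, F a * Complex.exp (-(2 * Real.pi * w a * ξ : ℝ) * Complex.I) ∂μ := by
  have hexp : Integrable (fun ξ : ℝ => Real.exp (-(2 * Real.pi * ε * ξ)))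
      (volume.restrict (Set.Ioi 0)) := by
    have := exp_neg_integrableOn_Ioi 0 (b := 2 * Real.pi * ε) (by positivity)
    simpa [neg_mul, IntegrableOn] using this
  have hint : Integrable (Function.uncurry fun (a : α) (ξ : ℝ) =>
      F a * ((Real.exp (-(2 * Real.pi * ε * ξ)) : ℂ) *
        Complex.exp (-(2 * Real.pi * w a * ξ : ℝ) * Complex.I)))
      (μ.prod (volume.restrict (Set.Ioi 0))) := by
    have h0 := hF.mul_prod (f := F) hexp.ofReal
    have : (Function.uncurry fun (a : α) (ξ : ℝ) =>
        F a * ((Real.exp (-(2 * Real.pi * ε * ξ)) : ℂ) *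
        Complex.exp (-(2 * Real.pi * w a * ξ : ℝ) * Complex.I))) =
        fun p : α × ℝ => (F p.1 * (Real.exp (-(2 * Real.pi * ε * p.2)) : ℂ)) *
          Complex.exp (-(2 * Real.pi * w p.1 * p.2 : ℝ) * Complex.I) := by
      ext p; simp only [Function.uncurry]; ring
    rw [this]
    refine h0.mul_bdd (c := 1) ?_ (.of_forall fun p => (norm_exp_neg_mul_I _).le)
    refine Measurable.aestronglyMeasurable ?_
    have hw' : Measurable fun p : α × ℝ => w p.1 := hw.comp measurable_fst
    fun_prop
  calc _ = ∫ a, ∫ ξ in Set.Ioi (0 : ℝ), F a * ((Real.exp (-(2 * Real.pi * ε * ξ)) : ℂ) *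
        Complex.exp (-(2 * Real.pi * w a * ξ : ℝ) * Complex.I)) ∂volume ∂μ := by
        refine integral_congr_ae (.of_forall fun a => ?_)
        simp only
        rw [integral_const_mul, resolventKernel_eq_integral hε]
    _ = _ := by
        rw [integral_integral_swap hint]
        refine integral_congr_ae (.of_forall fun ξ => ?_)
        simp only
        rw [← integral_const_mul]
        congr 1; ext a; ring

/-- Abel summation of the integral over the positive frequencies. -/
theorem tendsto_integral_mul_resolventKernel {α : Type*} [MeasurableSpace α] {μ : Measure α}
    [SFinite μ] {F : α → ℂ} (hF : Integrable F μ) {w : α → ℝ} (hw : Measurable w)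
    (hint : IntegrableOn (fun ξ : ℝ =>
      ∫ a, F a * Complex.exp (-(2 * Real.pi * w a * ξ : ℝ) * Complex.I) ∂μ) (Set.Ioi 0)) :
    Tendsto (fun ε : ℝ => ∫ a, F a * resolventKernel ε (w a) ∂μ) (𝓝[>] 0)
      (𝓝 (∫ ξ in Set.Ioi (0 : ℝ),
        ∫ a, F a * Complex.exp (-(2 * Real.pi * w a * ξ : ℝ) * Complex.I) ∂μ)) := by
  have heq : (fun ε : ℝ => ∫ ξ in Set.Ioi (0 : ℝ), (Real.exp (-(2 * Real.pi * ε * ξ)) : ℂ) *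
        ∫ a, F a * Complex.exp (-(2 * Real.pi * w a * ξ : ℝ) * Complex.I) ∂μ) =ᶠ[𝓝[>] 0]
      fun ε : ℝ => ∫ a, F a * resolventKernel ε (w a) ∂μ := by
    filter_upwards [self_mem_nhdsWithin] with ε hε
    exact (integral_mul_resolventKernel hF hw hε).symm
  refine Tendsto.congr' heq ?_
  refine tendsto_integral_filter_of_dominated_convergence _ ?_ ?_ hint.norm ?_
  · refine .of_forall fun ε => ?_
    exact (by fun_prop : Continuous fun ξ : ℝ =>
      (Real.exp (-(2 * Real.pi * ε * ξ)) : ℂ)).aestronglyMeasurable.mul hint.aestronglyMeasurable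
  · filter_upwards [self_mem_nhdsWithin] with ε hε
    refine (ae_restrict_iff' measurableSet_Ioi).2 (.of_forall fun ξ hξ => ?_)
    rw [norm_mul]
    refine mul_le_of_le_one_left (norm_nonneg _) ?_
    rw [Complex.norm_real, Real.norm_eq_abs, Real.abs_exp, Real.exp_le_one_iff]
    have h1 : (0 : ℝ) < ε := hε
    have h2 : (0 : ℝ) < ξ := hξ
    have := Real.pi_pos
    rw [neg_nonpos]
    positivity
  · refine .of_forall fun ξ => ?_
    have : Tendsto (fun ε : ℝ => (Real.exp (-(2 * Real.pi * ε * ξ)) : ℂ)) (𝓝[>] 0) (𝓝 1) := by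
      have h : Continuous fun ε : ℝ => (Real.exp (-(2 * Real.pi * ε * ξ)) : ℂ) := by fun_prop
      simpa using (h.tendsto 0).mono_left nhdsWithin_le_nhds
    simpa using this.mul_const _

/-! ### Schur test on the mixed region -/

/-- The part of the half-plane `s + t ≥ 0` outside the quadrant `s ≥ 0, t ≥ 0`. -/
def mixedRegion : Set (ℝ × ℝ) := {p | 0 ≤ p.1 + p.2 ∧ ¬(0 ≤ p.1 ∧ 0 ≤ p.2)}

theorem measurableSet_mixedRegion : MeasurableSet mixedRegion := by
  unfold mixedRegion
  have h1 : MeasurableSet {p : ℝ × ℝ | 0 ≤ p.1 + p.2} :=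
    measurableSet_le measurable_const (by fun_prop)
  have h2 : MeasurableSet {p : ℝ × ℝ | 0 ≤ p.1} := measurableSet_le measurable_const (by fun_prop)
  have h3 : MeasurableSet {p : ℝ × ℝ | 0 ≤ p.2} := measurableSet_le measurable_const (by fun_prop)
  exact h1.inter (h2.inter h3).compl

theorem swap_mem_mixedRegion {p : ℝ × ℝ} : p.swap ∈ mixedRegion ↔ p ∈ mixedRegion := by
  simp only [mixedRegion, Set.mem_ofPred_eq, Prod.fst_swap, Prod.snd_swap, add_comm p.2, and_comm]

theorem sub_ne_zero_of_mem_mixedRegion {p : ℝ × ℝ} (hp : p ∈ mixedRegion) : p.1 - p.2 ≠ 0 := by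
  obtain ⟨h1, h2⟩ := hp
  intro h
  exact h2 ⟨by linarith, by linarith⟩

/-- The absolute value `1 / |s - t|` of the kernel on the mixed region. -/
def mixedKernel (s t : ℝ) : ℝ≥0∞ :=
  mixedRegion.indicator (fun p : ℝ × ℝ => ENNReal.ofReal |p.1 - p.2|⁻¹) (s, t)

theorem measurable_mixedKernel : Measurable fun p : ℝ × ℝ => mixedKernel p.1 p.2 :=
  Measurable.indicator (by fun_prop) measurableSet_mixedRegion

theorem mixedKernel_comm (s t : ℝ) : mixedKernel s t = mixedKernel t s := by
  unfold mixedKernel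
  by_cases h : (s, t) ∈ mixedRegion
  · have h' : (t, s) ∈ mixedRegion := swap_mem_mixedRegion.2 h
    rw [Set.indicator_of_mem h, Set.indicator_of_mem h', abs_sub_comm]
  · have h' : (t, s) ∉ mixedRegion := fun h' => h (swap_mem_mixedRegion.2 h')
    rw [Set.indicator_of_notMem h, Set.indicator_of_notMem h']

theorem lintegral_rpow_neg_half {x : ℝ} (hx : 0 < x) :
    ∫⁻ t in Set.Ioc 0 x, ENNReal.ofReal (t ^ (-(1 / 2) : ℝ)) =
      ENNReal.ofReal (2 * x ^ (1 / 2 : ℝ)) := by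
  have hint : IntervalIntegrable (fun t : ℝ => t ^ (-(1 / 2) : ℝ)) volume 0 x :=
    intervalIntegral.intervalIntegrable_rpow' (by norm_num)
  rw [← ofReal_integral_eq_lintegral_ofReal ((intervalIntegrable_iff_integrableOn_Ioc_of_le hx.le).1 hint)]
  · rw [← intervalIntegral.integral_of_le hx.le, integral_rpow (.inl (by norm_num))]
    congr 1
    norm_num
    ring
  · refine (ae_restrict_iff' measurableSet_Ioc).2 (.of_forall fun t ht => ?_)
    exact Real.rpow_nonneg ht.1.le _

theorem lintegral_rpow_neg_three_halves {x : ℝ} (hx : 0 < x) :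
    ∫⁻ t in Set.Ioi x, ENNReal.ofReal (t ^ (-(3 / 2) : ℝ)) =
      ENNReal.ofReal (2 * x ^ (-(1 / 2) : ℝ)) := by
  rw [← ofReal_integral_eq_lintegral_ofReal (integrableOn_Ioi_rpow_of_lt (by norm_num) hx)]
  · rw [integral_Ioi_rpow_of_lt (by norm_num) hx]
    congr 1
    norm_num
    ring
  · refine (ae_restrict_iff' measurableSet_Ioi).2 (.of_forall fun t ht => ?_)
    exact Real.rpow_nonneg (hx.trans ht).le _

/-- The Schur test condition for the kernel on the mixed region with weight `|t|^(-1/2)`. -/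
theorem lintegral_mixedKernel_le (s : ℝ) (hs : s ≠ 0) :
    ∫⁻ t, mixedKernel s t * ENNReal.ofReal (|t| ^ (-(1 / 2) : ℝ)) ≤
      ENNReal.ofReal (2 * |s| ^ (-(1 / 2) : ℝ)) := by
  rcases hs.lt_or_gt with hs | hs
  -- For `s < 0` the slice lies in `t ≥ -s`, where `|s - t| ≥ t`; the integrand is at most
  -- `t^(-3/2)`.
  · have hs' : 0 < -s := by linarith
    calc _ ≤ ∫⁻ t, (Set.Ici (-s)).indicator
            (fun t => ENNReal.ofReal (t ^ (-(3 / 2) : ℝ))) t := by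
          refine lintegral_mono fun t => ?_
          unfold mixedKernel
          by_cases h : (s, t) ∈ mixedRegion
          · have hst : -s ≤ t := by have := h.1; simp only at this; linarith
            have ht : 0 < t := by linarith
            rw [Set.indicator_of_mem h, Set.indicator_of_mem (Set.mem_Ici.2 hst),
              ← ENNReal.ofReal_mul (by positivity)]
            refine ENNReal.ofReal_le_ofReal ?_
            rw [abs_of_pos ht, show (-(3 / 2) : ℝ) = -1 + -(1 / 2) by norm_num,
              Real.rpow_add ht, Real.rpow_neg_one]
            refine mul_le_mul_of_nonneg_right ?_ (by positivity)
            refine inv_anti₀ ht ?_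
            simp only
            rw [abs_of_neg (by linarith)]; linarith
          · rw [Set.indicator_of_notMem h, zero_mul]; exact zero_le
      _ = _ := by
          rw [lintegral_indicator measurableSet_Ici, ← restrict_Ioi_eq_restrict_Ici,
            lintegral_rpow_neg_three_halves hs', abs_of_neg hs]
  -- For `s > 0` the slice is `-s ≤ t < 0`, where `|s - t| ≥ s`; after `t ↦ -t` the integrand is at
  -- most `s⁻¹ t^(-1/2)`.
  · rw [← lintegral_neg_eq_self]
    calc _ ≤ ∫⁻ t, (Set.Ioc 0 s).indicator
            (fun t => ENNReal.ofReal s⁻¹ * ENNReal.ofReal (t ^ (-(1 / 2) : ℝ))) t := by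
          refine lintegral_mono fun t => ?_
          unfold mixedKernel
          by_cases h : (s, -t) ∈ mixedRegion
          · have hst : t ≤ s := by have := h.1; simp only at this; linarith
            have ht : 0 < t := by
              by_contra h'
              exact h.2 ⟨hs.le, by simp only; linarith⟩
            rw [Set.indicator_of_mem h, Set.indicator_of_mem (Set.mem_Ioc.2 ⟨ht, hst⟩)]
            rw [abs_neg, abs_of_pos ht]
            refine mul_le_mul_left (ENNReal.ofReal_le_ofReal (inv_anti₀ hs ?_)) _
            simp only
            rw [abs_of_pos (by linarith)]; linarith
          · rw [Set.indicator_of_notMem h, zero_mul]; exact zero_le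
      _ = _ := by
          rw [lintegral_indicator measurableSet_Ioc, lintegral_const_mul _ (by fun_prop),
            lintegral_rpow_neg_half hs, ← ENNReal.ofReal_mul (by positivity), abs_of_pos hs]
          congr 1
          rw [show (-(1 / 2) : ℝ) = -1 + 1 / 2 by norm_num, Real.rpow_add hs, Real.rpow_neg_one]
          ring

/-- Integrating over `p.2` first, the Schur bound produces `2|s|^(-1/2)`, which cancels the weight
`|s|^(1/2)`. -/
theorem lintegral_weight_mul_mixedKernel_le {f : ℝ → ℂ} (hf : Measurable f) :
    ∫⁻ p : ℝ × ℝ, ENNReal.ofReal (‖f p.1‖ ^ 2 * |p.1| ^ (1 / 2 : ℝ)) *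
      (mixedKernel p.1 p.2 * ENNReal.ofReal (|p.2| ^ (-(1 / 2) : ℝ))) ≤
      2 * ∫⁻ s, ‖f s‖ₑ ^ 2 := by
  have hK := measurable_mixedKernel
  rw [Measure.volume_eq_prod, lintegral_prod _ (by fun_prop)]
  rw [← lintegral_const_mul _ (by fun_prop)]
  refine lintegral_mono_ae ?_
  have h0 : ∀ᵐ s : ℝ, s ≠ 0 := by simp [ae_iff]
  filter_upwards [h0] with s hs
  have hKs : Measurable fun t => mixedKernel s t := hK.comp measurable_prodMk_left
  rw [lintegral_const_mul _ (by fun_prop)]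
  refine (mul_le_mul_right (lintegral_mixedKernel_le s hs) _).trans_eq ?_
  have hs' : 0 < |s| := abs_pos.2 hs
  rw [← ENNReal.ofReal_mul (by positivity), ← ofReal_norm, ← ENNReal.ofReal_pow (norm_nonneg _),
    show (2 : ℝ≥0∞) = ENNReal.ofReal 2 by simp, ← ENNReal.ofReal_mul (by norm_num)]
  congr 1
  rw [Real.rpow_neg hs'.le]
  field_simp

/-- Off the axes, `|u||v| ≤ |u|² |s/t|^(1/2) + |v|² |t/s|^(1/2)`. The symmetry of the kernel reduces
the second term to the first. -/
theorem lintegral_enorm_mul_mixedKernel_le {u v : ℝ → ℂ} (hu : Measurable u) (hv : Measurable v) :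
    ∫⁻ p : ℝ × ℝ, ‖u p.1‖ₑ * ‖v p.2‖ₑ * mixedKernel p.1 p.2 ≤
      2 * (∫⁻ s, ‖u s‖ₑ ^ 2) + 2 * ∫⁻ s, ‖v s‖ₑ ^ 2 := by
  have hK := measurable_mixedKernel
  have h2 : ∫⁻ p : ℝ × ℝ, ENNReal.ofReal (‖v p.2‖ ^ 2 * |p.2| ^ (1 / 2 : ℝ)) *
      (mixedKernel p.1 p.2 * ENNReal.ofReal (|p.1| ^ (-(1 / 2) : ℝ))) ≤
      2 * ∫⁻ s, ‖v s‖ₑ ^ 2 := by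
    refine le_trans (le_of_eq ?_) (lintegral_weight_mul_mixedKernel_le hv)
    rw [Measure.volume_eq_prod, ← lintegral_prod_swap]
    simp only [Prod.fst_swap, Prod.snd_swap]
    congr 1; ext p; rw [mixedKernel_comm]
  refine le_trans ?_ (add_le_add (lintegral_weight_mul_mixedKernel_le hu) h2)
  rw [← lintegral_add_left (by fun_prop)]
  refine lintegral_mono_ae ?_
  have h1 : ∀ᵐ p : ℝ × ℝ, p.1 ≠ 0 :=
    Measure.quasiMeasurePreserving_fst.ae (p := fun s : ℝ => s ≠ 0) (by simp [ae_iff])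
  have h2 : ∀ᵐ p : ℝ × ℝ, p.2 ≠ 0 :=
    Measure.quasiMeasurePreserving_snd.ae (p := fun s : ℝ => s ≠ 0) (by simp [ae_iff])
  filter_upwards [h1, h2] with ⟨s, t⟩ hs ht
  simp only at hs ht ⊢
  have hs' : 0 < |s| := abs_pos.2 hs
  have ht' : 0 < |t| := abs_pos.2 ht
  have ha : 0 < |s| ^ (1 / 2 : ℝ) := by positivity
  have hb : 0 < |t| ^ (1 / 2 : ℝ) := by positivity
  rw [mul_comm (mixedKernel s t), mul_comm (mixedKernel s t), ← mul_assoc, ← mul_assoc, ← add_mul]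
  refine mul_le_mul_left ?_ _
  rw [← ofReal_norm, ← ofReal_norm, ← ENNReal.ofReal_mul (by positivity),
    ← ENNReal.ofReal_mul (by positivity), ← ENNReal.ofReal_mul (by positivity),
    ← ENNReal.ofReal_add (by positivity) (by positivity)]
  refine ENNReal.ofReal_le_ofReal ?_
  rw [Real.rpow_neg hs'.le, Real.rpow_neg ht'.le]
  set a := |s| ^ (1 / 2 : ℝ)
  set b := |t| ^ (1 / 2 : ℝ)
  rw [← div_eq_mul_inv, ← div_eq_mul_inv, div_add_div _ _ hb.ne' ha.ne', le_div_iff₀ (by positivity)]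
  nlinarith [sq_nonneg (‖u s‖ * a - ‖v t‖ * b), mul_nonneg (mul_nonneg (norm_nonneg (u s)) (norm_nonneg (v t))) (mul_pos ha hb).le]

theorem enorm_mixed_form (u v : ℝ → ℂ) (p : ℝ × ℝ) :
    ‖mixedRegion.indicator
      (fun p : ℝ × ℝ => u p.1 * conj (v p.2) * resolventKernel 0 (p.1 - p.2)) p‖ₑ ≤
      ‖u p.1‖ₑ * ‖v p.2‖ₑ * mixedKernel p.1 p.2 := by
  unfold mixedKernel
  by_cases h : p ∈ mixedRegion
  · rw [Set.indicator_of_mem h, Set.indicator_of_mem (by exact h), enorm_mul, enorm_mul,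
      RCLike.enorm_conj]
    refine mul_le_mul_right ?_ _
    rw [← ofReal_norm]
    exact ENNReal.ofReal_le_ofReal
      (norm_resolventKernel_le_inv 0 (sub_ne_zero_of_mem_mixedRegion h))
  · rw [Set.indicator_of_notMem h]; simp

theorem lintegral_enorm_sq_eq (u : L2R) : ∫⁻ s, ‖u s‖ₑ ^ 2 = ENNReal.ofReal (‖u‖ ^ 2) := by
  have h := eLpNorm_nnreal_pow_eq_lintegral (f := (u : ℝ → ℂ)) (μ := volume) (p := 2) two_ne_zero
  simp only [NNReal.coe_ofNat, ENNReal.rpow_ofNat] at h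
  rw [← h, ENNReal.ofReal_pow (norm_nonneg _), Lp.norm_def,
    ENNReal.ofReal_toReal (Lp.eLpNorm_ne_top u)]
  rfl

/-! ### The bounded form on the mixed region -/

/-- The sesquilinear form on `L²(ℝ)` whose kernel is `1 / (2πi(s - t))` on the mixed region. -/
def mixedForm (u v : ℝ → ℂ) : ℂ :=
  ∫ p : ℝ × ℝ, mixedRegion.indicator
    (fun p : ℝ × ℝ => u p.1 * conj (v p.2) * resolventKernel 0 (p.1 - p.2)) p

theorem lintegral_mixedKernel_L2R_le (u v : L2R) :
    ∫⁻ p : ℝ × ℝ, ‖u p.1‖ₑ * ‖v p.2‖ₑ * mixedKernel p.1 p.2 ≤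
      ENNReal.ofReal (2 * ‖u‖ ^ 2 + 2 * ‖v‖ ^ 2) := by
  refine (lintegral_enorm_mul_mixedKernel_le (Lp.stronglyMeasurable u).measurable
    (Lp.stronglyMeasurable v).measurable).trans_eq ?_
  rw [lintegral_enorm_sq_eq, lintegral_enorm_sq_eq, ENNReal.ofReal_add (by positivity)
    (by positivity), ENNReal.ofReal_mul (by norm_num), ENNReal.ofReal_mul (by norm_num)]
  simp

theorem aestronglyMeasurable_mixed_integrand (ε : ℝ) (u v : L2R) :
    AEStronglyMeasurable (mixedRegion.indicator
    (fun p : ℝ × ℝ => u p.1 * conj (v p.2) * resolventKernel ε (p.1 - p.2))) := by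
  have hu := (Lp.stronglyMeasurable u).measurable
  have hv := (Lp.stronglyMeasurable v).measurable
  have hk := measurable_resolventKernel ε
  exact (Measurable.indicator (by fun_prop) measurableSet_mixedRegion).aestronglyMeasurable

theorem integrable_mixedForm (u v : L2R) : Integrable (mixedRegion.indicator
    (fun p : ℝ × ℝ => u p.1 * conj (v p.2) * resolventKernel 0 (p.1 - p.2))) :=
  ⟨aestronglyMeasurable_mixed_integrand 0 u v,
    (lintegral_mono (enorm_mixed_form u v)).trans_lt
      ((lintegral_mixedKernel_L2R_le u v).trans_lt ENNReal.ofReal_lt_top)⟩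

theorem mixedForm_congr {u u' v v' : ℝ → ℂ} (hu : u =ᵐ[volume] u') (hv : v =ᵐ[volume] v') :
    mixedForm u v = mixedForm u' v' := by
  refine integral_congr_ae ?_
  have h1 := Measure.quasiMeasurePreserving_fst (μ := (volume : Measure ℝ))
    (ν := (volume : Measure ℝ)) |>.ae hu
  have h2 := Measure.quasiMeasurePreserving_snd (μ := (volume : Measure ℝ))
    (ν := (volume : Measure ℝ)) |>.ae hv
  filter_upwards [h1, h2] with p hp1 hp2
  simp only [Set.indicator, hp1, hp2]

theorem mixedForm_add_left (u u' v : L2R) :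
    mixedForm (u + u' : L2R) v = mixedForm u v + mixedForm u' v := by
  rw [mixedForm_congr (Lp.coeFn_add u u') (Filter.EventuallyEq.refl _ _)]
  rw [mixedForm, mixedForm, mixedForm,
    ← integral_add (integrable_mixedForm u v) (integrable_mixedForm u' v)]
  congr 1; ext p
  simp only [Set.indicator, Pi.add_apply]
  split_ifs <;> ring

theorem mixedForm_smul_left (c : ℂ) (u v : L2R) :
    mixedForm (c • u : L2R) v = c * mixedForm u v := by
  rw [mixedForm_congr (Lp.coeFn_smul c u) (Filter.EventuallyEq.refl _ _)]
  rw [mixedForm, mixedForm, ← integral_const_mul]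
  congr 1; ext p
  simp only [Set.indicator, Pi.smul_apply, smul_eq_mul]
  split_ifs <;> ring

theorem conj_resolventKernel (ε w : ℝ) : conj (resolventKernel ε w) = resolventKernel ε (-w) := by
  have h2 : conj (2 : ℂ) = 2 := Complex.conj_ofNat 2
  simp only [resolventKernel, map_div₀, map_one, map_mul, map_add, Complex.conj_ofReal,
    Complex.conj_I, h2, Complex.ofReal_neg, mul_neg, neg_mul]

/-- The region is invariant under the swap, while conjugation reverses the sign of `s - t` in the
kernel. -/
theorem conj_mixedForm (u v : ℝ → ℂ) : conj (mixedForm u v) = mixedForm v u := by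
  rw [mixedForm, mixedForm, ← integral_conj, Measure.volume_eq_prod, ← integral_prod_swap]
  congr 1; ext p
  by_cases h : p ∈ mixedRegion
  · rw [Set.indicator_of_mem h, Set.indicator_of_mem (swap_mem_mixedRegion.2 h)]
    simp only [Prod.fst_swap, Prod.snd_swap]
    simp only [map_mul, conj_resolventKernel, RingHomCompTriple.comp_apply, RingHom.id_apply,
      neg_sub]
    ring
  · rw [Set.indicator_of_notMem h, Set.indicator_of_notMem (mt swap_mem_mixedRegion.1 h), map_zero]

theorem norm_mixedForm_le_add (u v : L2R) : ‖mixedForm u v‖ ≤ 2 * ‖u‖ ^ 2 + 2 * ‖v‖ ^ 2 := by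
  rw [← ENNReal.ofReal_le_ofReal_iff (by positivity), ofReal_norm]
  exact (enorm_integral_le_lintegral_enorm _).trans
    ((lintegral_mono (enorm_mixed_form u v)).trans (lintegral_mixedKernel_L2R_le u v))

theorem mixedForm_smul_right (c : ℂ) (u v : L2R) :
    mixedForm u (c • v : L2R) = conj c * mixedForm u v := by
  rw [← conj_mixedForm, mixedForm_smul_left, map_mul, conj_mixedForm]

theorem mixedForm_add_right (u v v' : L2R) :
    mixedForm u (v + v' : L2R) = mixedForm u v + mixedForm u v' := by
  rw [← conj_mixedForm, mixedForm_add_left, map_add, conj_mixedForm, conj_mixedForm]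

/-- The additive bound applied to unit vectors gives `2 + 2 = 4`; homogeneity does the rest. -/
theorem norm_mixedForm_le (u v : L2R) : ‖mixedForm u v‖ ≤ 4 * ‖u‖ * ‖v‖ := by
  rcases eq_or_ne u 0 with rfl | hu
  · have := mixedForm_smul_left 0 0 v
    rw [zero_smul, zero_mul] at this
    rw [this]; simp
  rcases eq_or_ne v 0 with rfl | hv
  · have := mixedForm_smul_right 0 u 0
    rw [zero_smul, map_zero, zero_mul] at this
    rw [this]; simp
  have hu' : 0 < ‖u‖ := norm_pos_iff.2 hu
  have hv' : 0 < ‖v‖ := norm_pos_iff.2 hv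
  have h := norm_mixedForm_le_add ((‖u‖⁻¹ : ℂ) • u) ((‖v‖⁻¹ : ℂ) • v)
  rw [mixedForm_smul_left, mixedForm_smul_right, norm_smul, norm_smul,
    norm_mul, norm_mul, RCLike.norm_conj, norm_inv, norm_inv, Complex.norm_real,
    Complex.norm_real, norm_norm, norm_norm, inv_mul_cancel₀ hu'.ne', inv_mul_cancel₀ hv'.ne'] at h
  rw [← mul_assoc, ← mul_inv, ← div_eq_inv_mul, div_le_iff₀ (by positivity)] at h
  linarith

/-- The bounded operator of the form `mixedForm`. -/
def mixedOperator : L2R →L[ℂ] L2R :=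
  InnerProductSpace.continuousLinearMapOfBilin
    (LinearMap.mkContinuous₂
      (LinearMap.mk₂'ₛₗ (starRingEnd ℂ) (RingHom.id ℂ) (fun u v : L2R => mixedForm v u)
        (fun _ _ _ => mixedForm_add_right _ _ _) (fun _ _ _ => mixedForm_smul_right _ _ _)
        (fun _ _ _ => mixedForm_add_left _ _ _) (fun _ _ _ => mixedForm_smul_left _ _ _))
      4 (fun u v => (norm_mixedForm_le v u).trans_eq (by ring)))

theorem inner_mixedOperator (u v : L2R) : inner ℂ (mixedOperator u) v = mixedForm v u := by
  rw [mixedOperator, InnerProductSpace.continuousLinearMapOfBilin_apply]; rfl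

theorem inner_mixedOperator_right (u v : L2R) :
    inner ℂ v (mixedOperator u) = mixedForm u v := by
  rw [← inner_conj_symm, inner_mixedOperator, conj_mixedForm]

/-! ### The quarter-plane operator and its self-adjointness -/

/-- Restriction of square integrable functions to the half-line `[0, ∞)`. -/
def restrictHalfLine : L2R →L[ℂ] Lp ℂ 2 ((volume : Measure ℝ).restrict (Set.Ici 0)) :=
  LpToLpRestrictCLM ℝ ℂ ℂ volume 2 (Set.Ici 0)

/-- Multiplication by the characteristic function of `[0, ∞)` on `L²(ℝ)`. -/
def cutoff : L2R →L[ℂ] L2R := restrictHalfLine.adjoint ∘L restrictHalfLine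

theorem inner_cutoff (u v : L2R) :
    inner ℂ v (cutoff u) = ∫ x in Set.Ioi (0 : ℝ), u x * conj (v x) := by
  rw [cutoff, ContinuousLinearMap.comp_apply, ContinuousLinearMap.adjoint_inner_right, L2.inner_def,
    restrict_Ioi_eq_restrict_Ici]
  refine integral_congr_ae ?_
  filter_upwards [LpToLpRestrictCLM_coeFn ℂ (Set.Ici (0 : ℝ)) u,
    LpToLpRestrictCLM_coeFn ℂ (Set.Ici (0 : ℝ)) v] with x hu hv
  rw [restrictHalfLine, hu, hv]
  rfl

theorem isSelfAdjoint_cutoff : IsSelfAdjoint cutoff :=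
  ContinuousLinearMap.isSelfAdjoint_iff'.2 (by
    rw [cutoff, ContinuousLinearMap.adjoint_comp, ContinuousLinearMap.adjoint_adjoint])

theorem cutoff_eq_toLp (u : L2R) :
    cutoff u = ((Lp.memLp u).indicator (measurableSet_Ici (a := (0 : ℝ)))).toLp _ := by
  refine ext_inner_left ℂ fun v => ?_
  rw [inner_cutoff, L2.inner_def, restrict_Ioi_eq_restrict_Ici, ← integral_indicator measurableSet_Ici]
  refine integral_congr_ae ?_
  filter_upwards [((Lp.memLp u).indicator (measurableSet_Ici (a := (0 : ℝ)))).coeFn_toLp] with x hx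
  rw [hx]
  simp only [Set.indicator]
  split_ifs
  · rfl
  · simp

/-- The Fourier transform as a bounded operator on `L²(ℝ)`. -/
def fourierL2 : L2R →L[ℂ] L2R :=
  (Lp.fourierTransformₗᵢ ℝ ℂ).toContinuousLinearEquiv

/-- The Weyl quantization of the characteristic function of the quarter-plane. -/
def quarterPlaneOperator : L2R →L[ℂ] L2R :=
  cutoff ∘L fourierL2.adjoint ∘L cutoff ∘L fourierL2 ∘L cutoff + mixedOperator

theorem isSelfAdjoint_mixedOperator : IsSelfAdjoint mixedOperator := by
  rw [ContinuousLinearMap.isSelfAdjoint_iff_isSymmetric]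
  intro u v
  exact (inner_mixedOperator u v).trans (inner_mixedOperator_right v u).symm

theorem isSelfAdjoint_comp_adjoint_comp {H : Type*} [NormedAddCommGroup H] [InnerProductSpace ℂ H]
    [CompleteSpace H] {S T : H →L[ℂ] H} (hS : IsSelfAdjoint S) (hT : IsSelfAdjoint T)
    (R : H →L[ℂ] H) : IsSelfAdjoint (S ∘L R.adjoint ∘L T ∘L R ∘L S) := by
  have h := (hT.adjoint_conj R).adjoint_conj S
  rw [hS.adjoint_eq] at h
  simpa only [ContinuousLinearMap.comp_assoc] using h

theorem isSelfAdjoint_quarterPlaneOperator : IsSelfAdjoint quarterPlaneOperator := by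
  exact (isSelfAdjoint_comp_adjoint_comp isSelfAdjoint_cutoff isSelfAdjoint_cutoff fourierL2).add
    isSelfAdjoint_mixedOperator

/-! ### The form as a limit of regularised integrals -/

/-- The half-plane `s + t ≥ 0`. -/
def halfPlane : Set (ℝ × ℝ) := {p | 0 ≤ p.1 + p.2}

theorem measurableSet_halfPlane : MeasurableSet halfPlane :=
  measurableSet_le measurable_const (by fun_prop)

/-- Dominated convergence: the Schur test makes `|u||v|/|s - t|` integrable on the mixed region, and
`s ≠ t` there. -/
theorem tendsto_mixed_integral (u v : L2R) :
    Tendsto (fun ε : ℝ => ∫ p : ℝ × ℝ, mixedRegion.indicator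
      (fun p : ℝ × ℝ => u p.1 * conj (v p.2) * resolventKernel ε (p.1 - p.2)) p) (𝓝[>] 0)
      (𝓝 (mixedForm u v)) := by
  have hu := (Lp.stronglyMeasurable u).measurable
  have hv := (Lp.stronglyMeasurable v).measurable
  have hmeas : Measurable (mixedRegion.indicator
      fun p : ℝ × ℝ => ‖u p.1‖ * ‖v p.2‖ * |p.1 - p.2|⁻¹) :=
    Measurable.indicator (by fun_prop) measurableSet_mixedRegion
  refine tendsto_integral_filter_of_dominated_convergence (mixedRegion.indicator
    fun p : ℝ × ℝ => ‖u p.1‖ * ‖v p.2‖ * |p.1 - p.2|⁻¹) ?_ ?_ ?_ ?_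
  · exact .of_forall fun ε => aestronglyMeasurable_mixed_integrand ε u v
  · refine .of_forall fun ε => .of_forall fun p => ?_
    by_cases h : p ∈ mixedRegion
    · rw [Set.indicator_of_mem h, Set.indicator_of_mem h, norm_mul, norm_mul, RCLike.norm_conj]
      gcongr
      exact norm_resolventKernel_le_inv ε (sub_ne_zero_of_mem_mixedRegion h)
    · rw [Set.indicator_of_notMem h, Set.indicator_of_notMem h, norm_zero]
  · refine ⟨hmeas.aestronglyMeasurable, ?_⟩
    refine lt_of_le_of_lt (lintegral_mono fun p => ?_)
      ((lintegral_mixedKernel_L2R_le u v).trans_lt ENNReal.ofReal_lt_top)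
    unfold mixedKernel
    by_cases h : p ∈ mixedRegion
    · rw [Set.indicator_of_mem h, Set.indicator_of_mem (by exact h), enorm_mul, enorm_mul,
        enorm_norm, enorm_norm, Real.enorm_of_nonneg (by positivity)]
    · rw [Set.indicator_of_notMem h]; simp
  · refine .of_forall fun p => ?_
    by_cases h : p ∈ mixedRegion
    · simp only [Set.indicator_of_mem h]
      refine Tendsto.const_mul _ ?_
      have hne := sub_ne_zero_of_mem_mixedRegion h
      unfold resolventKernel
      refine Tendsto.mono_left (ContinuousAt.tendsto (x := 0) ?_) nhdsWithin_le_nhds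
      refine ContinuousAt.div (by fun_prop) (by fun_prop) ?_
      have : ((p.1 - p.2 : ℝ) : ℂ) ≠ 0 := by exact_mod_cast hne
      rw [Complex.ofReal_zero, zero_add]
      exact mul_ne_zero (by simp [Real.pi_ne_zero]) (mul_ne_zero this Complex.I_ne_zero)
    · simp only [Set.indicator_of_notMem h]
      exact tendsto_const_nhds

theorem fourier_mul_conj_fourier {f g : ℝ → ℂ} (ξ : ℝ) :
    ∫ p : ℝ × ℝ, f p.1 * conj (g p.2) *
      Complex.exp (-(2 * Real.pi * (p.1 - p.2) * ξ : ℝ) * Complex.I) =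
      𝓕 f ξ * conj (𝓕 g ξ) := by
  rw [Real.fourier_eq', Real.fourier_eq', ← integral_conj, ← integral_prod_mul]
  rw [Measure.volume_eq_prod]
  congr 1; ext p
  simp only [smul_eq_mul, map_mul, ← Complex.exp_conj, Complex.conj_ofReal, Complex.conj_I]
  rw [mul_mul_mul_comm (Complex.exp _), ← Complex.exp_add, mul_comm]
  congr 2
  simp
  ring

/-- Abel summation for the product of the truncated functions. Integrability in `ξ` holds because
the transforms are in `L²`; `L¹` is what identifies them with Fourier integrals. -/
theorem tendsto_quadrant_integral (u v : L2R) (hu : Integrable u) (hv : Integrable v) :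
    Tendsto (fun ε : ℝ => ∫ p : ℝ × ℝ, (Set.Ici (0 : ℝ)).indicator u p.1 *
        conj ((Set.Ici (0 : ℝ)).indicator v p.2) * resolventKernel ε (p.1 - p.2)) (𝓝[>] 0)
      (𝓝 (inner ℂ v (cutoff (fourierL2.adjoint (cutoff (fourierL2 (cutoff u))))))) := by
  have hu1 : Integrable ((Set.Ici (0 : ℝ)).indicator u) := hu.indicator measurableSet_Ici
  have hv1 : Integrable ((Set.Ici (0 : ℝ)).indicator v) := hv.indicator measurableSet_Ici
  have hu2 := coeFn_fourier_toLp hu1 ((Lp.memLp u).indicator (measurableSet_Ici (a := (0 : ℝ))))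
  have hv2 := coeFn_fourier_toLp hv1 ((Lp.memLp v).indicator (measurableSet_Ici (a := (0 : ℝ))))
  rw [← cutoff_eq_toLp] at hu2 hv2
  have hprod : (fun ξ => 𝓕 ((Set.Ici (0 : ℝ)).indicator u) ξ *
      conj (𝓕 ((Set.Ici (0 : ℝ)).indicator v) ξ)) =ᵐ[volume]
      fun ξ => (fourierL2 (cutoff u)) ξ * conj ((fourierL2 (cutoff v)) ξ) := by
    filter_upwards [hu2, hv2] with ξ h1 h2
    rw [← h1, ← h2]; rfl
  have hval : inner ℂ v (cutoff (fourierL2.adjoint (cutoff (fourierL2 (cutoff u))))) =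
      ∫ ξ in Set.Ioi (0 : ℝ), 𝓕 ((Set.Ici (0 : ℝ)).indicator u) ξ *
        conj (𝓕 ((Set.Ici (0 : ℝ)).indicator v) ξ) := by
    rw [← isSelfAdjoint_cutoff.isSymmetric.apply_clm, ContinuousLinearMap.adjoint_inner_right,
      inner_cutoff]
    exact (integral_congr_ae (ae_restrict_of_ae hprod)).symm
  have hF : Integrable (fun p : ℝ × ℝ => (Set.Ici (0 : ℝ)).indicator u p.1 *
        conj ((Set.Ici (0 : ℝ)).indicator v p.2)) :=
    hu1.mul_prod (Complex.conjLIE.integrable_comp_iff.2 hv1)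
  have := tendsto_integral_mul_resolventKernel hF (w := fun p => p.1 - p.2) (by fun_prop) ?_
  · simp only [fourier_mul_conj_fourier] at this
    rw [hval]
    exact this
  · simp only [fourier_mul_conj_fourier]
    refine Integrable.integrableOn ?_
    refine Integrable.congr ?_ hprod.symm
    exact L2.integrable_inner (𝕜 := ℂ) (fourierL2 (cutoff v)) (fourierL2 (cutoff u))

theorem norm_resolventKernel_le {ε : ℝ} (hε : 0 < ε) (w : ℝ) : ‖resolventKernel ε w‖ ≤ ε⁻¹ := by
  have h1 : ε ≤ ‖(ε + w * Complex.I : ℂ)‖ := by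
    simpa [abs_of_pos hε] using Complex.abs_re_le_norm (ε + w * Complex.I : ℂ)
  have h2 : (1 : ℝ) ≤ ‖(2 * Real.pi : ℂ)‖ := by
    have : ‖(2 * Real.pi : ℂ)‖ = 2 * Real.pi := by
      simp [abs_of_pos Real.pi_pos]
    rw [this]; linarith [Real.pi_gt_three]
  rw [resolventKernel, norm_div, norm_one, one_div, norm_mul]
  refine inv_anti₀ hε ?_
  nlinarith

theorem integrable_mul_resolventKernel {F : ℝ × ℝ → ℂ} (hF : Integrable F) {ε : ℝ} (hε : 0 < ε) :
    Integrable fun p : ℝ × ℝ => F p * resolventKernel ε (p.1 - p.2) :=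
  hF.mul_bdd (c := ε⁻¹)
    ((measurable_resolventKernel ε).comp (by fun_prop)).aestronglyMeasurable
    (.of_forall fun _ => norm_resolventKernel_le hε _)

/-- The form of the quarter-plane operator is a limit of regularised absolutely convergent
integrals. -/
theorem tendsto_inner_quarterPlaneOperator (u v : L2R) (hu : Integrable u) (hv : Integrable v) :
    Tendsto (fun ε : ℝ => ∫ p : ℝ × ℝ, halfPlane.indicator
      (fun p : ℝ × ℝ => u p.1 * conj (v p.2)) p * resolventKernel ε (p.1 - p.2)) (𝓝[>] 0)
      (𝓝 (inner ℂ v (quarterPlaneOperator u))) := by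
  have h := (tendsto_quadrant_integral u v hu hv).add (tendsto_mixed_integral u v)
  rw [← inner_mixedOperator_right, ← inner_add_right] at h
  refine Tendsto.congr' ?_ h
  filter_upwards [self_mem_nhdsWithin] with ε hε
  have hu1 : Integrable ((Set.Ici (0 : ℝ)).indicator u) := hu.indicator measurableSet_Ici
  have hv1 : Integrable ((Set.Ici (0 : ℝ)).indicator v) := hv.indicator measurableSet_Ici
  rw [← integral_add]
  · congr 1; ext p
    -- The quadrant and the mixed region partition the half-plane.
    simp only [Set.indicator, mixedRegion, halfPlane, Set.mem_ofPred_eq, Set.mem_Ici]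
    by_cases h1 : 0 ≤ p.1 <;> by_cases h2 : 0 ≤ p.2
    · simp [h1, h2, add_nonneg h1 h2]
    · by_cases h3 : 0 ≤ p.1 + p.2 <;> simp [h2, h3]
    · by_cases h3 : 0 ≤ p.1 + p.2 <;> simp [h1, h3]
    · have h3 : ¬ 0 ≤ p.1 + p.2 := by push Not at *; linarith
      simp [h1, h3]
  · exact integrable_mul_resolventKernel
      (hu1.mul_prod (Complex.conjLIE.integrable_comp_iff.2 hv1)) hε
  · exact (integrable_mul_resolventKernel
      (hu.mul_prod (Complex.conjLIE.integrable_comp_iff.2 hv)) hε).indicator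
      measurableSet_mixedRegion

/-! ### Decay of the Wigner distribution of Schwartz functions -/

theorem SchwartzMap.exists_norm_le_inv_sq (u : 𝓢(ℝ, ℂ)) :
    ∃ C : ℝ, 0 ≤ C ∧ ∀ s, ‖u s‖ ≤ C * ((1 + s ^ 2) ^ 2)⁻¹ := by
  refine ⟨2 ^ 4 * ((Finset.Iic (4, 0)).sup fun m => SchwartzMap.seminorm ℝ m.1 m.2) u,
    mul_nonneg (by norm_num) (apply_nonneg _ _), fun s => ?_⟩
  have h := SchwartzMap.one_add_le_sup_seminorm_apply (𝕜 := ℝ) (m := (4, 0)) le_rfl le_rfl u s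
  rw [norm_iteratedFDeriv_zero] at h
  rw [← div_eq_mul_inv, le_div_iff₀ (by positivity)]
  refine le_trans ?_ h
  rw [mul_comm]
  refine mul_le_mul_of_nonneg_right ?_ (norm_nonneg _)
  have h1 : 1 + s ^ 2 ≤ (1 + ‖s‖) ^ 2 := by
    rw [Real.norm_eq_abs]
    nlinarith [abs_nonneg s, sq_abs s]
  calc (1 + s ^ 2) ^ 2 ≤ ((1 + ‖s‖) ^ 2) ^ 2 := pow_le_pow_left₀ (by positivity) h1 2
    _ = _ := by rw [← pow_mul]

/-- The product `ab` dominates `1 + x²`, and `2ab` dominates `1 + z²`, so one power of `ab` pays for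
each variable; hence the squares. -/
theorem inv_sq_mul_inv_sq_le (x z : ℝ) :
    ((1 + (x + z / 2) ^ 2) ^ 2)⁻¹ * ((1 + (x - z / 2) ^ 2) ^ 2)⁻¹ ≤
      2 * (1 + x ^ 2)⁻¹ * (1 + z ^ 2)⁻¹ := by
  set a := 1 + (x + z / 2) ^ 2 with ha
  set b := 1 + (x - z / 2) ^ 2 with hb
  have ha0 : 0 < a := by positivity
  have hb0 : 0 < b := by positivity
  have h1 : 1 + x ^ 2 ≤ a * b := by
    rw [ha, hb]
    nlinarith [mul_nonneg (sq_nonneg (x + z / 2)) (sq_nonneg (x - z / 2)), sq_nonneg z]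
  have h2 : 1 + z ^ 2 ≤ 2 * (a * b) := by
    rw [ha, hb]
    nlinarith [mul_nonneg (sq_nonneg (x + z / 2)) (sq_nonneg (x - z / 2)), sq_nonneg x]
  have hx : 0 < 1 + x ^ 2 := by positivity
  have hz : 0 < 1 + z ^ 2 := by positivity
  rw [← mul_inv, ← div_eq_mul_inv, ← div_eq_mul_inv, div_div, le_div_iff₀ (by positivity),
    inv_mul_eq_div, div_le_iff₀ (by positivity)]
  calc (1 + x ^ 2) * (1 + z ^ 2) ≤ (a * b) * (2 * (a * b)) :=
        mul_le_mul h1 h2 hz.le (by positivity)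
    _ = _ := by ring

/-- The function of `z` whose Fourier transform is the Wigner distribution at the point `x`. -/
def wignerKernel (u v : ℝ → ℂ) (x z : ℝ) : ℂ := u (x + z / 2) * conj (v (x - z / 2))

theorem wigner_eq_fourier (u v : ℝ → ℂ) (x ξ : ℝ) :
    wigner u v (x, ξ) = 𝓕 (wignerKernel u v x) ξ := by
  rw [wigner, Real.fourier_eq']
  congr 1; ext z
  rw [wignerKernel, smul_eq_mul, mul_comm]
  congr 3
  simp
  ring

theorem exists_norm_wignerKernel_le (u v : 𝓢(ℝ, ℂ)) :
    ∃ C : ℝ, 0 ≤ C ∧ ∀ x z, ‖wignerKernel u v x z‖ ≤ C * (1 + x ^ 2)⁻¹ * (1 + z ^ 2)⁻¹ := by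
  obtain ⟨A, hA, hu⟩ := u.exists_norm_le_inv_sq
  obtain ⟨B, hB, hv⟩ := v.exists_norm_le_inv_sq
  refine ⟨A * B * 2, by positivity, fun x z => ?_⟩
  rw [wignerKernel, norm_mul, RCLike.norm_conj]
  calc _ ≤ (A * ((1 + (x + z / 2) ^ 2) ^ 2)⁻¹) * (B * ((1 + (x - z / 2) ^ 2) ^ 2)⁻¹) :=
        mul_le_mul (hu _) (hv _) (norm_nonneg _) (by positivity)
    _ = A * B * (((1 + (x + z / 2) ^ 2) ^ 2)⁻¹ * ((1 + (x - z / 2) ^ 2) ^ 2)⁻¹) := by ring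
    _ ≤ A * B * (2 * (1 + x ^ 2)⁻¹ * (1 + z ^ 2)⁻¹) :=
        mul_le_mul_of_nonneg_left (inv_sq_mul_inv_sq_le x z) (by positivity)
    _ = _ := by ring

theorem continuous_wignerKernel (u v : 𝓢(ℝ, ℂ)) :
    Continuous fun q : ℝ × ℝ => wignerKernel u v q.1 q.2 := by
  have := u.continuous
  have := v.continuous
  unfold wignerKernel
  fun_prop

theorem integrable_wignerKernel (u v : 𝓢(ℝ, ℂ)) (x : ℝ) : Integrable (wignerKernel u v x) := by
  obtain ⟨C, -, hC⟩ := exists_norm_wignerKernel_le u v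
  refine (integrable_inv_one_add_sq.const_mul (C * (1 + x ^ 2)⁻¹)).mono' ?_ (.of_forall (hC x))
  exact ((continuous_wignerKernel u v).comp (by fun_prop : Continuous fun z : ℝ => (x, z))
    ).aestronglyMeasurable

theorem exists_norm_wigner_le (u v : 𝓢(ℝ, ℂ)) :
    ∃ C : ℝ, 0 ≤ C ∧ ∀ x ξ, ‖wigner u v (x, ξ)‖ ≤ C * (1 + x ^ 2)⁻¹ := by
  obtain ⟨C, hC0, hC⟩ := exists_norm_wignerKernel_le u v
  refine ⟨C * Real.pi, by positivity, fun x ξ => ?_⟩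
  have h := norm_integral_le_of_norm_le (μ := volume)
    (f := fun z : ℝ => u (x + z / 2) * conj (v (x - z / 2)) *
      Complex.exp (-(2 * Real.pi * z * ξ : ℝ) * Complex.I))
    (integrable_inv_one_add_sq.const_mul (C * (1 + x ^ 2)⁻¹)) (.of_forall fun z => ?_)
  · refine h.trans_eq ?_
    rw [integral_const_mul, integral_univ_inv_one_add_sq]
    ring
  · rw [norm_mul, norm_exp_neg_mul_I, mul_one]
    exact hC x z

theorem hasDerivAt_wignerKernel (u v : 𝓢(ℝ, ℂ)) (x z : ℝ) :
    HasDerivAt (wignerKernel u v x)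
      ((1 / 2 : ℂ) * wignerKernel (SchwartzMap.derivCLM ℂ ℂ u) v x z -
        (1 / 2 : ℂ) * wignerKernel u (SchwartzMap.derivCLM ℂ ℂ v) x z) z := by
  have h1 : HasDerivAt (fun z : ℝ => u (x + z / 2)) ((1 / 2 : ℝ) • deriv u (x + z / 2)) z :=
    HasDerivAt.scomp z (u.differentiableAt.hasDerivAt)
      (((hasDerivAt_id z).div_const 2).const_add x)
  have h2 : HasDerivAt (fun z : ℝ => v (x - z / 2)) ((-(1 / 2) : ℝ) • deriv v (x - z / 2)) z :=
    HasDerivAt.scomp z (v.differentiableAt.hasDerivAt)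
      (((hasDerivAt_id z).div_const 2).const_sub x)
  have h3 : HasDerivAt (fun z : ℝ => conj (v (x - z / 2)))
      (conj ((-(1 / 2) : ℝ) • deriv v (x - z / 2))) z :=
    (Complex.conjCLE : ℂ →L[ℝ] ℂ).hasFDerivAt.comp_hasDerivAt z h2
  refine (h1.mul h3).congr_deriv ?_
  simp only [wignerKernel, SchwartzMap.derivCLM_apply, Complex.real_smul, map_mul,
    Complex.conj_ofReal]
  push_cast
  ring

/-- A derivative in `z` becomes the factor `2πiξ`, so a power of `ξ` is traded for a derivative of
`u` or `v`; the gain `2π` and the factors `1/2` are discarded. -/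
theorem norm_mul_wigner_le (u v : 𝓢(ℝ, ℂ)) (x ξ : ℝ) :
    |ξ| * ‖wigner u v (x, ξ)‖ ≤ ‖wigner (SchwartzMap.derivCLM ℂ ℂ u) v (x, ξ)‖ +
      ‖wigner u (SchwartzMap.derivCLM ℂ ℂ v) (x, ξ)‖ := by
  have hd : deriv (wignerKernel u v x) =
      (1 / 2 : ℂ) • wignerKernel (SchwartzMap.derivCLM ℂ ℂ u) v x -
        (1 / 2 : ℂ) • wignerKernel u (SchwartzMap.derivCLM ℂ ℂ v) x :=
    funext fun z => (hasDerivAt_wignerKernel u v x z).deriv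
  have hi1 := (integrable_wignerKernel (SchwartzMap.derivCLM ℂ ℂ u) v x).smul (1 / 2 : ℂ)
  have hi2 := (integrable_wignerKernel u (SchwartzMap.derivCLM ℂ ℂ v) x).smul (1 / 2 : ℂ)
  have h := congrFun (Real.fourier_deriv (integrable_wignerKernel u v x)
    (fun z => (hasDerivAt_wignerKernel u v x z).differentiableAt) (hd ▸ hi1.sub hi2)) ξ
  have h4 : 𝓕 (deriv (wignerKernel u v x)) ξ =
      (1 / 2 : ℂ) * wigner (SchwartzMap.derivCLM ℂ ℂ u) v (x, ξ) -
        (1 / 2 : ℂ) * wigner u (SchwartzMap.derivCLM ℂ ℂ v) (x, ξ) := by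
    rw [hd, wigner_eq_fourier, wigner_eq_fourier, Real.fourier_eq, Real.fourier_eq, Real.fourier_eq,
      ← integral_const_mul, ← integral_const_mul, ← integral_sub]
    · congr 1; ext z
      simp only [Pi.sub_apply, Pi.smul_apply, Circle.smul_def, smul_eq_mul]
      ring
    · exact ((Real.fourierIntegral_convergent_iff ξ).2
        (integrable_wignerKernel (SchwartzMap.derivCLM ℂ ℂ u) v x)).const_mul _
    · exact ((Real.fourierIntegral_convergent_iff ξ).2
        (integrable_wignerKernel u (SchwartzMap.derivCLM ℂ ℂ v) x)).const_mul _
  rw [h4, ← wigner_eq_fourier] at h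
  have h5 := congrArg norm h
  have h6 : ‖(2 * Real.pi * Complex.I * ξ : ℂ)‖ = 2 * Real.pi * |ξ| := by
    simp [abs_of_pos Real.pi_pos]
  rw [norm_smul, h6] at h5
  have h7 := norm_sub_le ((1 / 2 : ℂ) * wigner (SchwartzMap.derivCLM ℂ ℂ u) v (x, ξ))
    ((1 / 2 : ℂ) * wigner u (SchwartzMap.derivCLM ℂ ℂ v) (x, ξ))
  have h8 : ‖(1 / 2 : ℂ)‖ = 1 / 2 := by norm_num
  rw [h5, norm_mul, norm_mul, h8] at h7
  have hpos : 0 ≤ |ξ| * ‖wigner u v (x, ξ)‖ := by positivity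
  nlinarith [Real.pi_gt_three, norm_nonneg (wigner (SchwartzMap.derivCLM ℂ ℂ u) v (x, ξ)),
    norm_nonneg (wigner u (SchwartzMap.derivCLM ℂ ℂ v) (x, ξ))]

theorem exists_norm_wigner_le_inv (u v : 𝓢(ℝ, ℂ)) :
    ∃ C : ℝ, 0 ≤ C ∧ ∀ x ξ, ‖wigner u v (x, ξ)‖ ≤ C * ((1 + x ^ 2)⁻¹ * (1 + ξ ^ 2)⁻¹) := by
  set D := SchwartzMap.derivCLM ℂ ℂ
  obtain ⟨C0, h0, hC0⟩ := exists_norm_wigner_le u v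
  obtain ⟨C1, h1, hC1⟩ := exists_norm_wigner_le (D (D u)) v
  obtain ⟨C2, h2, hC2⟩ := exists_norm_wigner_le (D u) (D v)
  obtain ⟨C3, h3, hC3⟩ := exists_norm_wigner_le u (D (D v))
  -- Applying `norm_mul_wigner_le` twice bounds `ξ²|W|`; the mixed derivative occurs twice.
  refine ⟨C0 + (C1 + 2 * C2 + C3), by positivity, fun x ξ => ?_⟩
  have hξ : 0 < 1 + ξ ^ 2 := by positivity
  rw [← mul_assoc, ← div_eq_mul_inv _ (1 + ξ ^ 2), le_div_iff₀ hξ]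
  have e1 := norm_mul_wigner_le u v x ξ
  have e2 := norm_mul_wigner_le (D u) v x ξ
  have e3 := norm_mul_wigner_le u (D v) x ξ
  have e4 := mul_le_mul_of_nonneg_left e1 (abs_nonneg ξ)
  rw [← mul_assoc, ← sq, sq_abs] at e4
  linarith [hC0 x ξ, hC1 x ξ, hC2 x ξ, hC3 x ξ]

theorem stronglyMeasurable_wigner (u v : 𝓢(ℝ, ℂ)) : StronglyMeasurable (wigner u v) := by
  have hu := u.continuous
  have hv := v.continuous
  have : Continuous fun q : (ℝ × ℝ) × ℝ => u (q.1.1 + q.2 / 2) * conj (v (q.1.1 - q.2 / 2)) *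
      Complex.exp (-(2 * Real.pi * q.2 * q.1.2 : ℝ) * Complex.I) := by fun_prop
  exact this.stronglyMeasurable.integral_prod_right

theorem integrable_wigner (u v : 𝓢(ℝ, ℂ)) : Integrable (wigner u v) := by
  obtain ⟨C, -, hC⟩ := exists_norm_wigner_le_inv u v
  exact ((integrable_inv_one_add_sq.mul_prod integrable_inv_one_add_sq).const_mul C).mono'
    (stronglyMeasurable_wigner u v).aestronglyMeasurable (.of_forall fun p => hC p.1 p.2)

/-! ### The Weyl identity -/

theorem measurePreserving_add_sub_half :
    MeasurePreserving fun q : ℝ × ℝ => (q.1 + q.2 / 2, q.1 - q.2 / 2) := by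
  -- Two fibrewise isometries: `x ↦ x + z/2 = s` at fixed `z`, then `z ↦ s - z = t` at fixed `s`.
  have h1 : MeasurePreserving (fun q : ℝ × ℝ => (q.1, q.2 + q.1 / 2))
      (volume.prod volume) (volume.prod volume) :=
    (MeasurePreserving.id volume).skew_product (g := fun z x : ℝ => x + z / 2) (by fun_prop)
      (.of_forall fun z => (measurePreserving_add_right volume (z / 2)).map_eq)
  have h2 : MeasurePreserving (fun q : ℝ × ℝ => (q.1, q.1 - q.2))
      (volume.prod volume) (volume.prod volume) :=
    (MeasurePreserving.id volume).skew_product (g := fun s z : ℝ => s - z) (by fun_prop)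
      (.of_forall fun s => (Measure.measurePreserving_sub_left volume s).map_eq)
  have hs := Measure.measurePreserving_swap (μ := (volume : Measure ℝ)) (ν := (volume : Measure ℝ))
  have := h2.comp (hs.comp (h1.comp hs))
  have he : (fun q : ℝ × ℝ => (q.1 + q.2 / 2, q.1 - q.2 / 2)) =
      (fun q : ℝ × ℝ => (q.1, q.1 - q.2)) ∘ Prod.swap ∘
        (fun q : ℝ × ℝ => (q.1, q.2 + q.1 / 2)) ∘ Prod.swap := by
    ext q
    · rfl
    · simp only [Function.comp, Prod.fst_swap, Prod.snd_swap]; ring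
  rw [he]
  exact this

/-- In the coordinates `(x, z)` the half-plane becomes `x ≥ 0` and `s - t` becomes `z`; each fibre
integral is a Wigner value. -/
theorem wigner_halfLine_integral (u v : 𝓢(ℝ, ℂ)) (ξ : ℝ) :
    ∫ p : ℝ × ℝ, halfPlane.indicator (fun p : ℝ × ℝ => u p.1 * conj (v p.2)) p *
      Complex.exp (-(2 * Real.pi * (p.1 - p.2) * ξ : ℝ) * Complex.I) =
    ∫ x, (Set.Ici (0 : ℝ)).indicator (fun x => wigner u v (x, ξ)) x := by
  have hF : Integrable (fun p : ℝ × ℝ => halfPlane.indicator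
      (fun p : ℝ × ℝ => u p.1 * conj (v p.2)) p *
      Complex.exp (-(2 * Real.pi * (p.1 - p.2) * ξ : ℝ) * Complex.I)) := by
    refine Integrable.mul_bdd (c := 1) ?_ ?_ (.of_forall fun p => (norm_exp_neg_mul_I _).le)
    · exact (u.integrable.mul_prod (Complex.conjLIE.integrable_comp_iff.2 v.integrable)).indicator
        measurableSet_halfPlane
    · exact (by fun_prop : Continuous fun p : ℝ × ℝ =>
        Complex.exp (-(2 * Real.pi * (p.1 - p.2) * ξ : ℝ) * Complex.I)).aestronglyMeasurable
  have hφ := measurePreserving_add_sub_half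
  rw [← hφ.map_eq, integral_map hφ.measurable.aemeasurable
    (by rw [hφ.map_eq]; exact hF.aestronglyMeasurable)]
  have hG := hφ.integrable_comp_of_integrable hF
  rw [Measure.volume_eq_prod] at hG ⊢
  refine (integral_prod _ hG).trans ?_
  congr 1; ext x
  have hmem : ∀ z : ℝ, ((x + z / 2, x - z / 2) : ℝ × ℝ) ∈ halfPlane ↔ 0 ≤ x := fun z => by
    simp only [halfPlane, Set.mem_ofPred_eq]
    constructor <;> intro h <;> linarith
  by_cases hx : 0 ≤ x
  · rw [Set.indicator_of_mem (Set.mem_Ici.2 hx), wigner]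
    congr 1; ext z
    simp only [Function.comp]
    rw [Set.indicator_of_mem ((hmem z).2 hx)]
    congr 5
    ring
  · rw [Set.indicator_of_notMem (by simpa using hx)]
    refine integral_eq_zero_of_ae (.of_forall fun z => ?_)
    simp only [Function.comp]
    rw [Set.indicator_of_notMem (by rwa [hmem z]), zero_mul]
    rfl

/-- Both sides are limits of the same regularised integral: one as the form of the operator, the
other by Abel summation followed by Fubini. -/
theorem isWeylQuantization_quarterPlaneOperator :
    IsWeylQuantization quarterPlaneSymbol quarterPlaneOperator := by
  intro u v
  have huL := u.coeFn_toLp 2 (volume : Measure ℝ)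
  have hvL := v.coeFn_toLp 2 (volume : Measure ℝ)
  have hlim := tendsto_inner_quarterPlaneOperator (u.toLp 2 volume) (v.toLp 2 volume)
    (u.integrable.congr huL.symm) (v.integrable.congr hvL.symm)
  have hF : Integrable (halfPlane.indicator fun p : ℝ × ℝ => u p.1 * conj (v p.2)) :=
    (u.integrable.mul_prod (Complex.conjLIE.integrable_comp_iff.2 v.integrable)).indicator
      measurableSet_halfPlane
  have hW : Integrable fun p : ℝ × ℝ => (Set.Ici (0 : ℝ)).indicator
      (fun x => wigner u v (x, p.2)) p.1 := by
    have : (fun p : ℝ × ℝ => (Set.Ici (0 : ℝ)).indicator (fun x => wigner u v (x, p.2)) p.1) =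
        {p : ℝ × ℝ | 0 ≤ p.1}.indicator (wigner u v) := by
      ext p; simp [Set.indicator]
    rw [this]
    exact (integrable_wigner u v).indicator (measurableSet_le measurable_const (by fun_prop))
  have hAbel := tendsto_integral_mul_resolventKernel hF (w := fun p => p.1 - p.2) (by fun_prop) ?_
  · refine (tendsto_nhds_unique hlim (hAbel.congr fun ε => ?_)).trans ?_
    · refine integral_congr_ae ?_
      filter_upwards [Measure.quasiMeasurePreserving_fst (μ := (volume : Measure ℝ))
        (ν := (volume : Measure ℝ)) |>.ae huL, Measure.quasiMeasurePreserving_snd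
        (μ := (volume : Measure ℝ)) (ν := (volume : Measure ℝ)) |>.ae hvL] with p h1 h2
      simp only [Set.indicator, h1, h2]
    · simp only [wigner_halfLine_integral]
      have hQ : (fun p : ℝ × ℝ => quarterPlaneSymbol p * wigner u v p) = fun p : ℝ × ℝ =>
          (Set.Ici (0 : ℝ)).indicator (fun ξ => (Set.Ici (0 : ℝ)).indicator
            (fun x => wigner u v (x, ξ)) p.1) p.2 := by
        ext p
        by_cases h1 : 0 ≤ p.1 <;> by_cases h2 : 0 ≤ p.2 <;>
          simp [quarterPlaneSymbol, Set.indicator, h1, h2]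
      rw [hQ, Measure.volume_eq_prod, integral_prod_symm, restrict_Ioi_eq_restrict_Ici,
        ← integral_indicator measurableSet_Ici]
      · congr 1; ext ξ
        by_cases h : 0 ≤ ξ <;> simp [Set.indicator, h]
      · have : (fun p : ℝ × ℝ => (Set.Ici (0 : ℝ)).indicator (fun ξ =>
            (Set.Ici (0 : ℝ)).indicator (fun x => wigner u v (x, ξ)) p.1) p.2) =
            {p : ℝ × ℝ | 0 ≤ p.2}.indicator (fun p : ℝ × ℝ => (Set.Ici (0 : ℝ)).indicator
              (fun x => wigner u v (x, p.2)) p.1) := by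
          ext p; simp [Set.indicator]
        rw [this]
        exact hW.indicator (measurableSet_le measurable_const (by fun_prop))
  · simp only [wigner_halfLine_integral]
    exact Integrable.integrableOn (Integrable.integral_prod_right hW)

/-! ### Cell integrals over the whole plane -/

/-- A second primitive of the regularised kernel. -/
def kernelPrimitive (η w : ℝ) : ℂ :=
  -(1 / (2 * Real.pi)) * ((η + w * Complex.I) * Complex.log (η + w * Complex.I) -
    (η + w * Complex.I))

/-- A second primitive of the limiting kernel. -/
def limitPrimitive (w : ℝ) : ℂ :=
  -(Complex.I / (2 * Real.pi)) * ((w * Real.log w - w : ℝ) : ℂ) + (|w| : ℝ) / 4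

theorem hasDerivAt_affine (η w : ℝ) :
    HasDerivAt (fun w : ℝ => (η + w * Complex.I : ℂ)) Complex.I w := by
  simpa using ((Complex.ofRealCLM.hasDerivAt (x := w)).mul_const Complex.I).const_add (η : ℂ)

theorem mem_slitPlane_of_pos {η : ℝ} (hη : 0 < η) (w : ℝ) :
    (η + w * Complex.I : ℂ) ∈ Complex.slitPlane := by
  left; simpa using hη

theorem hasDerivAt_log_affine {η : ℝ} (hη : 0 < η) (w : ℝ) :
    HasDerivAt (fun w : ℝ => Complex.log (η + w * Complex.I) / (2 * Real.pi * Complex.I))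
      (resolventKernel η w) w := by
  have h := ((hasDerivAt_affine η w).clog_real (mem_slitPlane_of_pos hη w)).div_const
    (2 * Real.pi * Complex.I)
  refine h.congr_deriv ?_
  have h0 := Complex.slitPlane_ne_zero (mem_slitPlane_of_pos hη w)
  have hpi : (Real.pi : ℂ) ≠ 0 := by exact_mod_cast Real.pi_ne_zero
  rw [resolventKernel]
  field_simp

theorem hasDerivAt_kernelPrimitive {η : ℝ} (hη : 0 < η) (w : ℝ) :
    HasDerivAt (kernelPrimitive η)
      (Complex.log (η + w * Complex.I) / (2 * Real.pi * Complex.I)) w := by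
  have ha := hasDerivAt_affine η w
  have h := ((ha.mul (ha.clog_real (mem_slitPlane_of_pos hη w))).sub ha).const_mul
    (-(1 / (2 * Real.pi)) : ℂ)
  refine h.congr_deriv ?_
  have h0 := Complex.slitPlane_ne_zero (mem_slitPlane_of_pos hη w)
  have hpi : (Real.pi : ℂ) ≠ 0 := by exact_mod_cast Real.pi_ne_zero
  have hI := Complex.I_sq
  generalize (η + w * Complex.I : ℂ) = z at h0 ⊢
  rw [mul_div_cancel₀ _ h0, add_sub_cancel_right]
  field_simp
  linear_combination (-Complex.log z) * hI

theorem continuous_log_affine {η : ℝ} (hη : 0 < η) :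
    Continuous fun w : ℝ => Complex.log (η + w * Complex.I) / (2 * Real.pi * Complex.I) :=
  continuous_iff_continuousAt.2 fun w => (hasDerivAt_log_affine hη w).continuousAt

theorem continuous_resolventKernel {η : ℝ} (hη : 0 < η) : Continuous (resolventKernel η) := by
  unfold resolventKernel
  refine Continuous.div continuous_const (by fun_prop) fun w => ?_
  have hpi : (Real.pi : ℂ) ≠ 0 := by exact_mod_cast Real.pi_ne_zero
  exact mul_ne_zero (mul_ne_zero two_ne_zero hpi)
    (Complex.slitPlane_ne_zero (mem_slitPlane_of_pos hη w))

theorem integral_resolventKernel {η : ℝ} (hη : 0 < η) (a b t : ℝ) :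
    ∫ s in a..b, resolventKernel η (s - t) =
      Complex.log (η + (b - t : ℝ) * Complex.I) / (2 * Real.pi * Complex.I) -
      Complex.log (η + (a - t : ℝ) * Complex.I) / (2 * Real.pi * Complex.I) := by
  rw [intervalIntegral.integral_comp_sub_right (resolventKernel η)]
  exact intervalIntegral.integral_eq_sub_of_hasDerivAt (fun w _ => hasDerivAt_log_affine hη w)
    ((continuous_resolventKernel hη).intervalIntegrable _ _)

theorem integral_log_affine {η : ℝ} (hη : 0 < η) (a b c : ℝ) :
    ∫ t in a..b, Complex.log (η + (c - t : ℝ) * Complex.I) / (2 * Real.pi * Complex.I) =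
      kernelPrimitive η (c - a) - kernelPrimitive η (c - b) := by
  rw [intervalIntegral.integral_comp_sub_left
    (fun w : ℝ => Complex.log (η + w * Complex.I) / (2 * Real.pi * Complex.I))]
  exact intervalIntegral.integral_eq_sub_of_hasDerivAt
    (fun w _ => hasDerivAt_kernelPrimitive hη w)
    ((continuous_log_affine hη).intervalIntegrable _ _)

/-- The tensor product of the characteristic functions of two cells. -/
def cellProduct (ε : ℝ) (j k : ℤ) (p : ℝ × ℝ) : ℂ :=
  (Set.Ioo ((j : ℝ) * ε) (((j : ℝ) + 1) * ε)).indicator 1 p.1 *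
    (Set.Ioo ((k : ℝ) * ε) (((k : ℝ) + 1) * ε)).indicator 1 p.2

theorem integrable_cellProduct (ε : ℝ) (j k : ℤ) : Integrable (cellProduct ε j k) :=
  ((integrable_indicator_iff measurableSet_Ioo).2
    (integrableOn_const (by simp) (by simp) : IntegrableOn (fun _ : ℝ => (1 : ℂ)) _ _)).mul_prod
  ((integrable_indicator_iff measurableSet_Ioo).2
    (integrableOn_const (by simp) (by simp) : IntegrableOn (fun _ : ℝ => (1 : ℂ)) _ _))

theorem integral_Ioo_indicator_mul (a : ℝ) (f : ℝ → ℂ) :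
    ∫ s, (Set.Ioo a (a + 1)).indicator (1 : ℝ → ℂ) s * f s = ∫ s in a..a + 1, f s := by
  rw [intervalIntegral.integral_of_le (by linarith), integral_Ioc_eq_integral_Ioo,
    ← integral_indicator measurableSet_Ioo]
  congr 1; ext s
  simp only [Set.indicator, Pi.one_apply]
  split_ifs <;> simp

/-- Each integration takes a difference of a primitive in `w = s - t`; the two together form a
second difference. -/
theorem integral_cellProduct {η : ℝ} (hη : 0 < η) (j k : ℤ) :
    ∫ p, cellProduct 1 j k p * resolventKernel η (p.1 - p.2) =
      kernelPrimitive η (j - k + 1) - 2 * kernelPrimitive η (j - k) +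
        kernelPrimitive η (j - k - 1) := by
  have hi := integrable_mul_resolventKernel (integrable_cellProduct 1 j k) hη
  rw [Measure.volume_eq_prod] at hi ⊢
  rw [integral_prod_symm _ hi]
  have h1 : ∀ t : ℝ, ∫ s : ℝ, cellProduct 1 j k (s, t) * resolventKernel η (s - t) =
      (Set.Ioo (k : ℝ) (k + 1)).indicator (1 : ℝ → ℂ) t *
        (Complex.log (η + (j + 1 - t : ℝ) * Complex.I) / (2 * Real.pi * Complex.I) -
          Complex.log (η + (j - t : ℝ) * Complex.I) / (2 * Real.pi * Complex.I)) := by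
    intro t
    rw [← integral_resolventKernel hη, ← integral_Ioo_indicator_mul, ← integral_const_mul]
    congr 1; ext s
    simp only [cellProduct, mul_one]
    ring
  simp only [h1]
  have hc : ∀ c : ℝ, IntervalIntegrable (fun t : ℝ =>
      Complex.log (η + (c - t : ℝ) * Complex.I) / (2 * Real.pi * Complex.I)) volume k (k + 1) :=
    fun c => ((continuous_log_affine hη).comp
      (by fun_prop : Continuous fun t : ℝ => c - t)).intervalIntegrable _ _
  rw [integral_Ioo_indicator_mul, intervalIntegral.integral_sub (hc _) (hc _),
    integral_log_affine hη, integral_log_affine hη]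
  rw [show (j + 1 - k : ℝ) = j - k + 1 by ring, show (j + 1 - (k + 1) : ℝ) = j - k by ring,
    show (j - (k + 1) : ℝ) = j - k - 1 by ring]
  ring

theorem tendsto_kernelPrimitive (w : ℝ) :
    Tendsto (fun η : ℝ => kernelPrimitive η w) (𝓝[>] 0) (𝓝 (limitPrimitive w)) := by
  have hpi : (Real.pi : ℂ) ≠ 0 := by exact_mod_cast Real.pi_ne_zero
  rcases eq_or_ne w 0 with rfl | hw
  -- At `w = 0` the logarithm has no limit, but `η log η` extends continuously by `0`.
  · have h : Continuous fun η : ℝ => -(1 / (2 * Real.pi) : ℂ) * ((η * Real.log η - η : ℝ) : ℂ) := by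
      have := Real.continuous_mul_log
      fun_prop
    have h' := (h.tendsto 0).mono_left (nhdsWithin_le_nhds (s := Set.Ioi 0))
    have hl : limitPrimitive 0 = -(1 / (2 * Real.pi) : ℂ) * ((0 * Real.log 0 - 0 : ℝ) : ℂ) := by
      simp [limitPrimitive]
    rw [hl]
    refine h'.congr' ?_
    filter_upwards [self_mem_nhdsWithin] with η hη
    have hη' : (0 : ℝ) ≤ η := le_of_lt hη
    simp [kernelPrimitive, Complex.ofReal_log hη']
  · have hmem : ((0 : ℝ) + w * Complex.I : ℂ) ∈ Complex.slitPlane := by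
      right; simpa using hw
    have hcont : ContinuousAt (fun η : ℝ => kernelPrimitive η w) 0 := by
      unfold kernelPrimitive
      have h1 : ContinuousAt (fun η : ℝ => (η + w * Complex.I : ℂ)) 0 := by fun_prop
      have h2 := h1.clog hmem
      fun_prop
    have hval : kernelPrimitive 0 w = limitPrimitive w := by
      -- The principal argument of `iw` is `sgn(w) π/2`; multiplied by `w` it gives the `|w|` term.
      have hlog : Complex.log (w * Complex.I) =
          Real.log w + (w / |w| : ℝ) * (Real.pi / 2 * Complex.I) := by
        rcases hw.lt_or_gt with h | h
        · rw [show (w * Complex.I : ℂ) = (-w : ℝ) * (-Complex.I) by push_cast; ring,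
            Complex.log_ofReal_mul (by linarith) (by simp), Complex.log_neg_I, Real.log_neg_eq_log,
            abs_of_neg h, div_neg, div_self hw]
          push_cast; ring
        · rw [Complex.log_ofReal_mul h (by simp), Complex.log_I, abs_of_pos h, div_self hw]
          push_cast; ring
      have habs : (w : ℂ) * (w / |w| : ℝ) = (|w| : ℝ) := by
        norm_cast
        field_simp
        rw [sq_abs]
      have hI := Complex.I_sq
      rw [kernelPrimitive, limitPrimitive, Complex.ofReal_zero, zero_add, hlog]
      generalize ((w / |w| : ℝ) : ℂ) = σ at habs
      rw [← habs]
      push_cast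
      field_simp
      linear_combination (-4 * Real.pi * w * σ) * hI
    rw [← hval]
    exact hcont.tendsto.mono_left nhdsWithin_le_nhds

theorem Phi_eq (l : ℤ) : Phi l = 1 / (2 * Real.pi) *
    (((l + 1 : ℝ) * Real.log (l + 1) - (l + 1)) - 2 * (l * Real.log l - l) +
      ((l - 1) * Real.log (l - 1) - (l - 1))) := by
  have h1 : ∀ y : ℝ, Real.log |y / (y - 1)| = Real.log y - Real.log (y - 1) := by
    intro y
    rw [Real.log_abs]
    -- The conventions `log 0 = 0` and `1/0 = 0` make the splitting valid even at `y = 0` and `y =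
    -- 1`.
    rcases eq_or_ne y 0 with rfl | h0
    · simp
    rcases eq_or_ne y 1 with rfl | h2
    · simp
    exact Real.log_div h0 (sub_ne_zero.2 h2)
  have h2 : IntervalIntegrable (fun y : ℝ => Real.log (y - 1)) volume l (l + 1) := by
    simpa using (intervalIntegral.intervalIntegrable_log' (a := l - 1) (b := l)).comp_sub_right 1
  rw [Phi]
  simp only [h1]
  rw [intervalIntegral.integral_sub intervalIntegral.intervalIntegrable_log' h2,
    intervalIntegral.integral_comp_sub_right Real.log, integral_log, integral_log]
  ring_nf

theorem Phi_neg (l : ℤ) : Phi (-l) = -Phi l := by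
  rw [Phi_eq, Phi_eq]
  push_cast
  rw [show (-(l : ℝ) + 1) = -(l - 1) by ring, show (-(l : ℝ) - 1) = -(l + 1) by ring,
    Real.log_neg_eq_log, Real.log_neg_eq_log, Real.log_neg_eq_log]
  ring

/-- The second difference of `|w|` on the integers is `2δ`, whence `δ/2`; the odd part gives `-iΦ(j
- k) = iΦ(k - j)`. -/
theorem limitPrimitive_second_difference (j k : ℤ) :
    limitPrimitive (j - k + 1) - 2 * limitPrimitive (j - k) + limitPrimitive (j - k - 1) =
      kron j k / 2 + Complex.I * (Phi (k - j) : ℂ) := by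
  have habs : |(j - k + 1 : ℝ)| - 2 * |(j - k : ℝ)| + |(j - k - 1 : ℝ)| =
      if j = k then 2 else 0 := by
    split_ifs with h
    · subst h; norm_num
    · rcases lt_or_gt_of_ne h with h | h
      · have : (j : ℝ) + 1 ≤ k := by exact_mod_cast h
        rw [abs_of_nonpos (by linarith), abs_of_nonpos (by linarith), abs_of_nonpos (by linarith)]
        ring
      · have : (k : ℝ) + 1 ≤ j := by exact_mod_cast h
        rw [abs_of_nonneg (by linarith), abs_of_nonneg (by linarith), abs_of_nonneg (by linarith)]
        ring
  rw [show k - j = -(j - k) by ring, Phi_neg, Phi_eq]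
  have hk : kron j k / 2 = ((if j = k then 2 else 0 : ℝ) : ℂ) / 4 := by
    rw [kron]; split_ifs <;> norm_num
  rw [hk, ← habs]
  simp only [limitPrimitive]
  push_cast
  ring

theorem tendsto_integral_cellProduct (j k : ℤ) :
    Tendsto (fun η : ℝ => ∫ p, cellProduct 1 j k p * resolventKernel η (p.1 - p.2)) (𝓝[>] 0)
      (𝓝 (kron j k / 2 + Complex.I * (Phi (k - j) : ℂ))) := by
  rw [← limitPrimitive_second_difference]
  refine Tendsto.congr' ?_ (((tendsto_kernelPrimitive (j - k + 1)).sub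
    ((tendsto_kernelPrimitive (j - k)).const_mul 2)).add (tendsto_kernelPrimitive (j - k - 1)))
  filter_upwards [self_mem_nhdsWithin] with η hη
  exact (integral_cellProduct hη j k).symm

/-! ### Matrix entries and scaling -/

theorem tendsto_gridEntry (ε : ℝ) (j k : ℤ) :
    Tendsto (fun η : ℝ => ∫ p, halfPlane.indicator (cellProduct ε j k) p *
      resolventKernel η (p.1 - p.2)) (𝓝[>] 0) (𝓝 (gridEntry quarterPlaneOperator ε j k)) := by
  have hcoe : ∀ m : ℤ, (gridIndicator ε m : ℝ → ℂ) =ᵐ[volume]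
      (Set.Ioo ((m : ℝ) * ε) (((m : ℝ) + 1) * ε)).indicator 1 := fun m => indicatorConstLp_coeFn
  have hint : ∀ m : ℤ, Integrable (gridIndicator ε m : ℝ → ℂ) := fun m =>
    integrable_indicatorConstLp _ _ _
  refine (tendsto_inner_quarterPlaneOperator _ _ (hint j) (hint k)).congr fun η => ?_
  refine integral_congr_ae ?_
  filter_upwards [Measure.quasiMeasurePreserving_fst (μ := (volume : Measure ℝ))
    (ν := (volume : Measure ℝ)) |>.ae (hcoe j), Measure.quasiMeasurePreserving_snd
    (μ := (volume : Measure ℝ)) (ν := (volume : Measure ℝ)) |>.ae (hcoe k)] with p h1 h2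
  congr 1
  have : ((gridIndicator ε j : ℝ → ℂ) p.1 * conj ((gridIndicator ε k : ℝ → ℂ) p.2)) =
      cellProduct ε j k p := by
    rw [h1, h2, cellProduct]
    congr 1
    simp only [Set.indicator]
    split_ifs <;> simp
  simp only [Set.indicator, this]

theorem cellProduct_eq_zero {ε : ℝ} {j k : ℤ} {p : ℝ × ℝ}
    (h : ¬(p.1 ∈ Set.Ioo ((j : ℝ) * ε) (((j : ℝ) + 1) * ε) ∧
      p.2 ∈ Set.Ioo ((k : ℝ) * ε) (((k : ℝ) + 1) * ε))) : cellProduct ε j k p = 0 := by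
  rw [cellProduct]
  rcases not_and_or.1 h with h | h
  · rw [Set.indicator_of_notMem h, zero_mul]
  · rw [Set.indicator_of_notMem h, mul_zero]

theorem gridEntry_of_nonneg {j k : ℤ} (h : 0 ≤ j + k) :
    gridEntry quarterPlaneOperator 1 j k = kron j k / 2 + Complex.I * (Phi (k - j) : ℂ) := by
  have hS : halfPlane.indicator (cellProduct 1 j k) = cellProduct 1 j k := by
    rw [Set.indicator_eq_self]
    intro p hp
    by_contra hn
    refine hp (cellProduct_eq_zero fun hm => hn ?_)
    have h' : (0 : ℝ) ≤ j + k := by exact_mod_cast h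
    have h1 := hm.1.1
    have h2 := hm.2.1
    simp only [halfPlane, Set.mem_ofPred_eq]
    linarith
  have := tendsto_gridEntry 1 j k
  rw [hS] at this
  exact tendsto_nhds_unique this (tendsto_integral_cellProduct j k)

theorem gridEntry_of_lt {j k : ℤ} (h : j + k < -1) :
    gridEntry quarterPlaneOperator 1 j k = 0 := by
  have hS : halfPlane.indicator (cellProduct 1 j k) = 0 := by
    rw [Set.indicator_eq_zero', Set.disjoint_left]
    intro p hp hn
    refine hp (cellProduct_eq_zero fun hm => ?_)
    have h' : (j : ℝ) + k + 1 + 1 ≤ 0 := by exact_mod_cast (by omega : j + k + 1 + 1 ≤ 0)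
    have h1 := hm.1.2
    have h2 := hm.2.2
    simp only [halfPlane, Set.mem_ofPred_eq] at hn
    linarith
  have := tendsto_gridEntry 1 j k
  simp only [hS, Pi.zero_apply, zero_mul, integral_zero] at this
  exact tendsto_nhds_unique this tendsto_const_nhds

theorem measurePreserving_antidiagonal_reflection :
    MeasurePreserving fun p : ℝ × ℝ => (-p.2, -p.1) := by
  have hs := Measure.measurePreserving_swap (μ := (volume : Measure ℝ)) (ν := (volume : Measure ℝ))
  exact ((Measure.measurePreserving_neg volume).prod (Measure.measurePreserving_neg volume)).comp hs

theorem ae_add_ne_zero : ∀ᵐ p : ℝ × ℝ, p.1 + p.2 ≠ 0 :=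
  (Measure.quasiMeasurePreserving_snd.comp
    (measurePreserving_prod_add (volume : Measure ℝ) volume).quasiMeasurePreserving).ae
    (p := fun x : ℝ => x ≠ 0) (by simp [ae_iff])

/-- The reflection `(s, t) ↦ (-t, -s)` exchanges the half-plane with its complement, up to the null
line `s + t = 0`. -/
theorem integral_halfPlane_eq_half {f : ℝ × ℝ → ℂ} (hf : Integrable f)
    (hsymm : ∀ p : ℝ × ℝ, f (-p.2, -p.1) = f p) :
    ∫ p, halfPlane.indicator f p = (∫ p, f p) / 2 := by
  have hρ := measurePreserving_antidiagonal_reflection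
  have hf1 := hf.indicator measurableSet_halfPlane
  have h1 : ∫ p, halfPlane.indicator f p = ∫ p : ℝ × ℝ, halfPlane.indicator f (-p.2, -p.1) := by
    conv_lhs => rw [← hρ.map_eq, integral_map hρ.measurable.aemeasurable
      (by rw [hρ.map_eq]; exact hf1.aestronglyMeasurable)]
  have h2 : ∫ p, f p = (∫ p, halfPlane.indicator f p) +
      ∫ p : ℝ × ℝ, halfPlane.indicator f (-p.2, -p.1) := by
    refine Eq.trans ?_ (integral_add hf1 (hρ.integrable_comp_of_integrable hf1))
    refine integral_congr_ae ?_
    filter_upwards [ae_add_ne_zero] with p hp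
    have hm : ∀ q : ℝ × ℝ, q ∈ halfPlane ↔ 0 ≤ q.1 + q.2 := fun q => Iff.rfl
    simp only [Set.indicator, hm, hsymm]
    rcases hp.lt_or_gt with h | h
    · rw [if_neg (by linarith), if_pos (by linarith), zero_add]
    · rw [if_pos (by linarith), if_neg (by linarith), add_zero]
  rw [h2, ← h1]
  ring

/-- The product cell is invariant under that reflection, which also fixes `s - t`; so the half-plane
keeps half of the full integral. -/
theorem gridEntry_of_eq_neg_one {j k : ℤ} (h : j + k = -1) :
    gridEntry quarterPlaneOperator 1 j k = Complex.I * (Phi (k - j) : ℂ) / 2 := by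
  have hk : kron j k = 0 := by rw [kron, if_neg (by omega)]
  have hlim := (tendsto_integral_cellProduct j k).div_const 2
  rw [hk, zero_div, zero_add] at hlim
  refine tendsto_nhds_unique (tendsto_gridEntry 1 j k) (hlim.congr' ?_)
  filter_upwards [self_mem_nhdsWithin] with η hη
  rw [← integral_halfPlane_eq_half
    (integrable_mul_resolventKernel (integrable_cellProduct 1 j k) hη)]
  · congr 1; ext p
    simp only [Set.indicator]
    split_ifs <;> simp
  · intro p
    have hj : (j : ℝ) = -k - 1 := by
      have : (j : ℝ) + k = -1 := by exact_mod_cast h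
      linarith
    congr 1
    · rw [cellProduct, cellProduct, mul_comm]
      congr 1
      · simp only [Set.indicator, Set.mem_Ioo, hj, Pi.one_apply]
        refine if_congr ?_ rfl rfl
        constructor <;> rintro ⟨h1, h2⟩ <;> constructor <;> linarith
      · simp only [Set.indicator, Set.mem_Ioo, hj, Pi.one_apply]
        refine if_congr ?_ rfl rfl
        constructor <;> rintro ⟨h1, h2⟩ <;> constructor <;> linarith
    · congr 1; ring

theorem resolventKernel_mul {ε : ℝ} (hε : 0 < ε) (η w : ℝ) :
    resolventKernel η (ε * w) = (ε : ℂ)⁻¹ * resolventKernel (η / ε) w := by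
  have hε' : (ε : ℂ) ≠ 0 := by exact_mod_cast hε.ne'
  rw [resolventKernel, resolventKernel, one_div, one_div, ← mul_inv]
  congr 1
  push_cast
  field_simp

/-- Dilation by `ε` preserves the half-plane, multiplies area by `ε²` and the kernel by `ε⁻¹`, and
changes `η` to `η/ε`, which is harmless in the limit. -/
theorem gridEntry_scale {ε : ℝ} (hε : 0 < ε) (j k : ℤ) :
    gridEntry quarterPlaneOperator ε j k = ε * gridEntry quarterPlaneOperator 1 j k := by
  have hε' : (ε : ℂ) ≠ 0 := by exact_mod_cast hε.ne'
  have hdiv : Tendsto (fun η : ℝ => η / ε) (𝓝[>] 0) (𝓝[>] 0) := by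
    refine tendsto_nhdsWithin_iff.2 ⟨?_, ?_⟩
    · have : Continuous fun η : ℝ => η / ε := by fun_prop
      simpa using (this.tendsto 0).mono_left nhdsWithin_le_nhds
    · filter_upwards [self_mem_nhdsWithin] with η hη
      exact div_pos hη hε
  refine tendsto_nhds_unique (tendsto_gridEntry ε j k)
    ((((tendsto_gridEntry 1 j k).comp hdiv).const_mul (ε : ℂ)).congr fun η => ?_)
  have h := Measure.integral_comp_smul (volume : Measure (ℝ × ℝ)) (fun p : ℝ × ℝ =>
    halfPlane.indicator (cellProduct ε j k) p * resolventKernel η (p.1 - p.2)) ε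
  have hfin : Module.finrank ℝ (ℝ × ℝ) = 2 := by simp
  rw [hfin, abs_of_pos (by positivity)] at h
  have h2 : ∀ p : ℝ × ℝ, halfPlane.indicator (cellProduct ε j k) (ε • p) *
      resolventKernel η ((ε • p).1 - (ε • p).2) =
      (ε : ℂ)⁻¹ * (halfPlane.indicator (cellProduct 1 j k) p *
        resolventKernel (η / ε) (p.1 - p.2)) := by
    intro p
    have hmem : ε • p ∈ halfPlane ↔ p ∈ halfPlane := by
      simp only [halfPlane, Set.mem_ofPred_eq, Prod.smul_fst, Prod.smul_snd, smul_eq_mul,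
        ← mul_add, mul_nonneg_iff_of_pos_left hε]
    have hcell : cellProduct ε j k (ε • p) = cellProduct 1 j k p := by
      simp only [cellProduct, Set.indicator, Set.mem_Ioo, Prod.smul_fst, Prod.smul_snd,
        smul_eq_mul, mul_comm _ ε, mul_lt_mul_iff_right₀ hε, mul_one, Pi.one_apply]
    rw [Prod.smul_fst, Prod.smul_snd, smul_eq_mul, smul_eq_mul, ← mul_sub,
      resolventKernel_mul hε]
    by_cases hp : p ∈ halfPlane
    · rw [Set.indicator_of_mem hp, Set.indicator_of_mem (hmem.2 hp), hcell]
      ring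
    · rw [Set.indicator_of_notMem hp, Set.indicator_of_notMem (mt hmem.1 hp)]
      ring
  simp only [h2] at h
  rw [integral_const_mul, Complex.real_smul] at h
  push_cast at h
  simp only [Function.comp]
  field_simp at h ⊢
  exact h

/-! ### Uniqueness and compression to `ℓ²(ℤ)` -/

theorem IsWeylQuantization.unique {a : ℝ × ℝ → ℂ} {A B : L2R →L[ℂ] L2R}
    (hA : IsWeylQuantization a A) (hB : IsWeylQuantization a B) : B = A := by
  have hd : DenseRange fun u : 𝓢(ℝ, ℂ) => (u.toLp 2 volume : L2R) :=
    SchwartzMap.denseRange_toLpCLM (μ := (volume : Measure ℝ)) (p := 2) ENNReal.ofNat_ne_top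
  refine DFunLike.coe_injective (hd.equalizer B.continuous A.continuous (funext fun u => ?_))
  refine hd.eq_of_inner_left ℂ fun v => ?_
  have h := congrArg conj ((hB u v).trans (hA u v).symm)
  rwa [inner_conj_symm, inner_conj_symm] at h

theorem orthonormal_gridIndicator : Orthonormal ℂ (gridIndicator 1) := by
  rw [orthonormal_iff_ite]
  intro j k
  rw [gridIndicator, gridIndicator, L2.inner_indicatorConstLp_one_indicatorConstLp_one _ _
    measure_Ioo_lt_top.ne measure_Ioo_lt_top.ne]
  split_ifs with h
  · subst h
    simp [Measure.real, Real.volume_Ioo]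
  · have hd : Set.Ioo ((j : ℝ) * 1) ((j + 1) * 1) ∩ Set.Ioo ((k : ℝ) * 1) ((k + 1) * 1) = ∅ := by
      rw [← Set.disjoint_iff_inter_eq_empty, Set.disjoint_left]
      rintro x ⟨h1, h2⟩ ⟨h3, h4⟩
      have h5 : (j : ℝ) < k + 1 := by linarith
      have h6 : (k : ℝ) < j + 1 := by linarith
      have h5' : j < k + 1 := by exact_mod_cast h5
      have h6' : k < j + 1 := by exact_mod_cast h6
      omega
    rw [hd]
    simp

/-- The embedding of `ℓ²(ℤ)` in `L²(ℝ)` as the functions constant on the cells `(j, j + 1)`. -/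
def stepEmbedding : ell2Z →L[ℂ] L2R :=
  orthonormal_gridIndicator.orthogonalFamily.linearIsometry.toContinuousLinearMap

theorem stepEmbedding_single (j : ℤ) (c : ℂ) :
    stepEmbedding (lp.single 2 j c) = c • gridIndicator 1 j :=
  orthonormal_gridIndicator.orthogonalFamily.linearIsometry_apply_single c

/-- The compression of an operator on `L²(ℝ)` to the step functions. -/
def stepCompression (A : L2R →L[ℂ] L2R) : ell2Z →L[ℂ] ell2Z :=
  stepEmbedding.adjoint ∘L A ∘L stepEmbedding

/-- The series is the image of the basis expansion of `z` under the continuous functional that reads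
off coordinate `k`. -/
theorem isMatrixOperator_stepCompression (A : L2R →L[ℂ] L2R) :
    IsMatrixOperator (fun j k : ℤ => gridEntry A 1 j k) (stepCompression A) := by
  intro z k
  have h1 : stepCompression A z k = inner ℂ (gridIndicator 1 k) (A (stepEmbedding z)) := by
    have h := lp.inner_single_left (𝕜 := ℂ) k (1 : ℂ) (stepCompression A z)
    rw [stepCompression, ContinuousLinearMap.comp_apply, ContinuousLinearMap.adjoint_inner_right,
      stepEmbedding_single, one_smul] at h
    rw [ContinuousLinearMap.comp_apply] at h
    rw [h]
    simp [stepCompression]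
  rw [h1]
  have h2 := ((lp.hasSum_single ENNReal.ofNat_ne_top z).mapL
    (innerSL ℂ (gridIndicator 1 k) ∘L A ∘L stepEmbedding))
  refine Eq.mpr (congrArg (fun f : ℤ → ℂ => HasSum f _) (funext fun j => ?_)) h2
  rw [ContinuousLinearMap.comp_apply, ContinuousLinearMap.comp_apply, stepEmbedding_single,
    map_smul, map_smul, smul_eq_mul, mul_comm]
  rfl

end

theorem proposition3p1 :
    ∃ A : L2R →L[ℂ] L2R,
      IsWeylQuantization quarterPlaneSymbol A ∧
      (∀ B : L2R →L[ℂ] L2R, IsWeylQuantization quarterPlaneSymbol B → B = A) ∧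
      (∀ ε : ℝ, 0 < ε → ∀ j k : ℤ, gridEntry A ε j k = (ε : ℂ) * gridEntry A 1 j k) ∧
      (∀ j k : ℤ, gridEntry A 1 j k =
        indN j * (kron j k / 2) +
          Complex.I * (indN (j + k) * (Phi (k - j) : ℂ) +
            kron j (-k - 1) / 2 * (Phi (2 * k + 1) : ℂ))) ∧
      (∀ j k : ℤ, gridEntry A 1 j k =
        indN j * indN k * (kron j k / 2) +
          Complex.I * (Phi (k - j) : ℂ) * (indN (j + k) + kron (j + k + 1) 0 / 2)) ∧
      ∃ Q : ell2Z →L[ℂ] ell2Z,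
        IsMatrixOperator (fun j k : ℤ => gridEntry A 1 j k) Q ∧ IsSelfAdjoint Q := by
  refine ⟨quarterPlaneOperator, isWeylQuantization_quarterPlaneOperator,
    fun B hB => isWeylQuantization_quarterPlaneOperator.unique hB,
    fun ε hε => gridEntry_scale hε, fun j k => ?_, fun j k => ?_,
    stepCompression quarterPlaneOperator, isMatrixOperator_stepCompression _,
    isSelfAdjoint_quarterPlaneOperator.adjoint_conj stepEmbedding⟩
  · rcases lt_trichotomy (j + k) (-1) with h | h | h
    · rw [gridEntry_of_lt h]
      -- On the diagonal `j = k` the sign of `j + k` is that of `j`, so the indicator of `j` only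
      -- discards the diagonal where the entry vanishes.
      have h1 : indN j * kron j k = 0 := by
        rw [indN, kron]; split_ifs <;> first | omega | simp
      rw [show indN (j + k) = 0 from if_neg (by omega),
        show kron j (-k - 1) = 0 from if_neg (by omega)]
      linear_combination (-1 / 2) * h1
    -- By parity `j ≠ k` when `j + k = -1`, and then `k - j = 2k + 1`.
    · rw [gridEntry_of_eq_neg_one h, indN, kron, kron, indN, if_neg (c := j = k) (by omega),
        if_neg (c := 0 ≤ j + k) (by omega), if_pos (c := j = -k - 1) (by omega),
        show k - j = 2 * k + 1 by omega]
      ring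
    · have h1 : indN j * kron j k = kron j k := by
        rw [indN, kron]; split_ifs <;> first | omega | simp
      rw [gridEntry_of_nonneg (by omega), show indN (j + k) = 1 from if_pos (by omega),
        show kron j (-k - 1) = 0 from if_neg (by omega)]
      linear_combination (-1 / 2) * h1
  · rcases lt_trichotomy (j + k) (-1) with h | h | h
    · rw [gridEntry_of_lt h, show indN (j + k) = 0 from if_neg (by omega),
        show kron (j + k + 1) 0 = 0 from if_neg (by omega)]
      have h1 : indN j * indN k = 0 := by
        rw [indN, indN]; split_ifs <;> first | omega | simp
      rw [h1]
      ring
    · rw [gridEntry_of_eq_neg_one h, show indN (j + k) = 0 from if_neg (by omega),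
        show kron (j + k + 1) 0 = 1 from if_pos (by omega),
        show kron j k = 0 from if_neg (by omega)]
      ring
    · have h1 : indN j * indN k * kron j k = kron j k := by
        rw [indN, indN, kron]; split_ifs <;> first | omega | simp
      rw [gridEntry_of_nonneg (by omega), show indN (j + k) = 1 from if_pos (by omega),
        show kron (j + k + 1) 0 = 0 from if_neg (by omega)]
      linear_combination (-1 / 2) * h1
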